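/- Let $\mathcal A$ be a finite alphabet, give $\mathcal A^{\mathbb Z}$ the product of the discrete topologies, and let $\sigma$ be the left shift, $\sigma(x)_i = x_{i+1}$. Let $x \in \mathcal A^{\mathbb Z}$ be a point that is recurrent (every finite word that occurs in $x$ occurs in $x$ at least at two different positions) and aperiodic (there is no integer $p \neq 0$ with $\sigma^p(x) = x$), and let $X = \overline{\{\sigma^n(x) : n \in \mathbb Z\}}$ be its orbit closure. Let $c_X(n)$ denote the number of words of length $n$ that occur in points of $X$. If \[\limsup_{n \to \infty} \frac{c_X(n)}{n} < 3,\] then $X$ is uniquely ergodic, that is, there is exactly one $\sigma$-invariant Borel probability measure on $X$. -/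

import Mathlib

open Filter MeasureTheory
open SymbolicDynamics.FullShift (Subshift shift)

/-- The `ℤ`-orbit `{σⁿ x : n ∈ ℤ}` of a bi-infinite sequence `x`; here `shift n x = σⁿ x`,
that is `(shift n x) i = x (n + i)`. -/
def shiftOrbit {A : Type*} (x : ℤ → A) : Set (ℤ → A) :=
  Set.range fun n : ℤ => shift n x

/-- The word `w = w₀ ⋯ w_{n-1}` occurs in `x` at position `i`:
`x_i x_{i+1} ⋯ x_{i+n-1} = w`. -/
def OccursAt {A : Type*} {n : ℕ} (w : Fin n → A) (x : ℤ → A) (i : ℤ) : Prop :=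
  ∀ k : Fin n, x (i + (k : ℕ)) = w k

/-- A point is recurrent if every word occurring in it occurs at least twice, that is, at two
different positions. -/
def RecurrentPoint {A : Type*} (x : ℤ → A) : Prop :=
  ∀ (n : ℕ) (w : Fin n → A) (i : ℤ), OccursAt w x i → ∃ j : ℤ, j ≠ i ∧ OccursAt w x j

/-- A point is aperiodic if no nontrivial power of the shift fixes it. -/
def AperiodicPoint {A : Type*} (x : ℤ → A) : Prop :=
  ∀ p : ℤ, p ≠ 0 → shift p x ≠ x

/-- The set of words of length `n` that occur in some point of `X`. -/
def wordsOfLength {A : Type*} [TopologicalSpace A] (X : Subshift A ℤ) (n : ℕ) :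
    Set (Fin n → A) :=
  {w | ∃ y ∈ X.carrier, ∃ i : ℤ, OccursAt w y i}

/-- The complexity function `c_X(n)`: the number of words of length `n` in `X`
(a finite number as soon as the alphabet is finite). -/
noncomputable def complexity {A : Type*} [TopologicalSpace A] (X : Subshift A ℤ) (n : ℕ) : ℕ :=
  (wordsOfLength X n).ncard

/-- `X` is uniquely ergodic: there is exactly one shift-invariant Borel probability measure on `X`.
A measure on `X` is written as a measure on the full shift that gives the complement of the
closed set `X` measure zero. For a finite discrete alphabet with its Borel `σ`-algebra, the
product `σ`-algebra on `ℤ → A` is the Borel one. -/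
def UniquelyErgodic {A : Type*} [TopologicalSpace A] [MeasurableSpace A]
    (X : Subshift A ℤ) : Prop :=
  ∃! μ : Measure (ℤ → A),
    IsProbabilityMeasure μ ∧ MeasurePreserving (shift (1 : ℤ)) μ μ ∧ μ X.carrierᶜ = 0

/-! Two different invariant probability measures would give some word masses `a < b`, so at every
length `x` has blocks in which the frequency of that word is at most `a` and others in which it is
at least `b`. Recoding by factors makes the word a letter, and a reflection makes every factor recur
to the right. By subadditivity (`eventually_exists_above`), every large scale `n` has windows of
length `20 n` in which all blocks of length at least `K ≈ δ n` have mean below `γ = (a + b) / 2`,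
and others in which all have mean above `γ`. A low factor and a high factor then share no block of
length `K` (`NoOverlap`).

Write `P` for `numFactors x`. The aim is `P (n + 1) ≥ P n + 3` for all large `n`, which contradicts
`P n ≤ (3 - η) n`. Suppose `P (n + 1) ≤ P n + 2`. The low and high windows contain more positions
than there are factors of length `n`, so the graph of these factors has a loop `C` of low factors
and a disjoint loop `H` of high ones. Recurrence makes `x` leave both. The two exits use up the
permitted growth, so the graph is exactly `C`, `H` and one path each way (`LoopPair`).

Growth persists (`three_mul_lt_numFactors_add`): if it falls from at least three at `m` to at most
two at `m + 1`, some bispecial factor of length `m` avoids the edges leaving the loops. The periods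
of the loops and `NoOverlap` restrict its place so much that loops and paths together have nearly `3
(m + 1)` vertices, more than `P (m + 1)` allows.

Growth occurs (`GoodScale.exists_numFactors_add_three_le`): take the shortest run along either loop,
spanning `N` letters. The opposite windows at scale `N` force a much longer run along the same loop.
The two runs give two right special factors of length `N + 1`, and a factor with means on the other
side of `γ` gives a third. -/

/-- The factor of length `n` of `x` at position `i`. -/
def factor {B : Type*} (x : ℤ → B) (n : ℕ) (i : ℤ) : Fin n → B := fun k => x (i + (k : ℕ))

/-- The positions `i` and `j` carry the same factor of length `n`. -/
def SameFactor {B : Type*} (x : ℤ → B) (n : ℕ) (i j : ℤ) : Prop :=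
  ∀ s : ℤ, 0 ≤ s → s < n → x (i + s) = x (j + s)

/-- The number of factors of length `n` of `x`. -/
noncomputable def numFactors {B : Type*} (x : ℤ → B) (n : ℕ) : ℕ :=
  (Set.range (factor x n)).ncard

/-! ### Counting factors through special factors -/

section Counting

variable {B : Type*} {x : ℤ → B} {n m : ℕ} {i j k : ℤ}

theorem factor_eq_iff : factor x n i = factor x n j ↔ SameFactor x n i j := by
  constructor
  · intro h s hs hsn
    have := congrFun h ⟨s.toNat, by omega⟩
    simpa [factor, Int.toNat_of_nonneg hs] using this
  · intro h
    funext k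
    exact h k (by omega) (by have := k.2; omega)

theorem SameFactor.refl (i : ℤ) : SameFactor x n i i := fun _ _ _ => rfl

theorem SameFactor.symm (h : SameFactor x n i j) : SameFactor x n j i :=
  fun s h0 h1 => (h s h0 h1).symm

theorem SameFactor.trans (h : SameFactor x n i j) (h' : SameFactor x n j k) :
    SameFactor x n i k :=
  fun s h0 h1 => (h s h0 h1).trans (h' s h0 h1)

theorem SameFactor.sub (h : SameFactor x n i j) {a : ℤ} (ha : 0 ≤ a) (ham : a + m ≤ n) :
    SameFactor x m (i + a) (j + a) := by
  intro s h0 h1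
  have := h (a + s) (by omega) (by omega)
  simpa [add_assoc] using this

theorem SameFactor.mono (h : SameFactor x n i j) (hm : m ≤ n) : SameFactor x m i j := by
  simpa using h.sub (m := m) (a := 0) le_rfl (by omega)

theorem SameFactor.tail (h : SameFactor x (n + 1) i j) : SameFactor x n (i + 1) (j + 1) :=
  h.sub (by omega) (by push_cast; omega)

theorem SameFactor.extend_right (h : SameFactor x n i j) (h' : x (i + n) = x (j + n)) :
    SameFactor x (n + 1) i j := by
  intro s h0 h1
  rcases eq_or_ne s n with rfl | hs
  · exact h'
  · exact h s h0 (by push_cast at h1; omega)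

theorem SameFactor.extend_left (h : SameFactor x n i j) (h' : x (i - 1) = x (j - 1)) :
    SameFactor x (n + 1) (i - 1) (j - 1) := by
  intro s h0 h1
  rcases eq_or_ne s 0 with rfl | hs
  · simpa using h'
  · have := h (s - 1) (by omega) (by push_cast at h1; omega)
    rw [show i - 1 + s = i + (s - 1) by ring, show j - 1 + s = j + (s - 1) by ring, this]

/-- A position whose factor of length `n` can be followed by two different letters. -/
def RightSpecial (x : ℤ → B) (n : ℕ) (i : ℤ) : Prop :=
  ∃ j, SameFactor x n j i ∧ x (j + n) ≠ x (i + n)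

/-- A position whose factor of length `n` can be preceded by two different letters. -/
def LeftSpecial (x : ℤ → B) (n : ℕ) (i : ℤ) : Prop :=
  ∃ j, SameFactor x n j i ∧ x (j - 1) ≠ x (i - 1)

theorem SameFactor.head (h : SameFactor x (n + 1) i j) : SameFactor x n i j :=
  h.mono (by omega)

theorem SameFactor.last (h : SameFactor x (n + 1) i j) : x (i + n) = x (j + n) :=
  h n (by omega) (by push_cast; omega)

theorem SameFactor.first (h : SameFactor x (n + 1) i j) : x i = x j := by
  simpa using h 0 le_rfl (by push_cast; omega)

theorem SameFactor.succ_of_not_rightSpecial (h : SameFactor x n i j)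
    (hj : ¬ RightSpecial x n j) : SameFactor x (n + 1) i j := by
  by_contra hc
  exact hj ⟨i, h, fun h' => hc (h.extend_right h')⟩

theorem SameFactor.pred_of_not_leftSpecial (h : SameFactor x n i j)
    (hj : ¬ LeftSpecial x n j) : SameFactor x (n + 1) (i - 1) (j - 1) := by
  by_contra hc
  exact hj ⟨i, h, fun h' => hc (h.extend_left h')⟩

/-- Merging classes of a finite-valued function lowers the number of values by at least the
number of values that become redundant. -/
theorem ncard_range_add_card_le {U V : Type*} {u : ℤ → U} {v : ℤ → V}
    (hfin : (Set.range u).Finite) (huv : ∀ i j, u i = u j → v i = v j) (T : Finset ℤ)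
    (hT : Set.InjOn u T) (hred : ∀ i ∈ T, ∃ j, v j = v i ∧ ∀ i' ∈ T, u j ≠ u i') :
    (Set.range v).ncard + T.card ≤ (Set.range u).ncard := by
  classical
  set g : U → V := fun a => if h : ∃ i, u i = a then v h.choose else v 0 with hg
  have hgu : ∀ i, g (u i) = v i := by
    intro i
    have h : ∃ j, u j = u i := ⟨i, rfl⟩
    simp only [hg, h, dif_pos]
    exact huv _ _ h.choose_spec
  have hsub : Set.range v ⊆ g '' (Set.range u \ u '' T) := by
    rintro _ ⟨i, rfl⟩
    by_cases hi : u i ∈ u '' T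
    · obtain ⟨i', hi', h⟩ := hi
      obtain ⟨j, hj, hj'⟩ := hred i' hi'
      refine ⟨u j, ⟨⟨j, rfl⟩, ?_⟩, ?_⟩
      · rintro ⟨k, hk, hk'⟩
        exact hj' k hk hk'.symm
      · rw [hgu, hj]; exact huv _ _ h
    · exact ⟨u i, ⟨⟨i, rfl⟩, hi⟩, hgu i⟩
  have h1 : (Set.range v).ncard ≤ (Set.range u \ u '' T).ncard :=
    (Set.ncard_le_ncard hsub ((hfin.sdiff).image _)).trans (Set.ncard_image_le hfin.sdiff)
  have h2 : (u '' (T : Set ℤ)).ncard = T.card := by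
    rw [Set.InjOn.ncard_image hT, Set.ncard_coe_finset]
  have h3 := Set.ncard_sdiff_add_ncard_of_subset
    (show u '' (T : Set ℤ) ⊆ Set.range u from Set.image_subset_range _ _) hfin
  omega

variable [Finite B]

theorem finite_range_factor (x : ℤ → B) (n : ℕ) : (Set.range (factor x n)).Finite :=
  Set.toFinite _

theorem card_le_numFactors (T : Finset ℤ)
    (hT : ∀ i ∈ T, ∀ j ∈ T, SameFactor x n i j → i = j) : T.card ≤ numFactors x n := by
  have h : Set.InjOn (factor x n) T := fun i hi j hj h => hT i hi j hj (factor_eq_iff.1 h)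
  rw [← Set.ncard_coe_finset, ← Set.InjOn.ncard_image h]
  exact Set.ncard_le_ncard (Set.image_subset_range _ _) (finite_range_factor x n)

theorem numFactors_add_card_le_right (T : Finset ℤ)
    (hT : ∀ i ∈ T, ∀ j ∈ T, SameFactor x (n + 1) i j → i = j)
    (hred : ∀ i ∈ T, ∃ j, SameFactor x n j i ∧ ∀ i' ∈ T, ¬ SameFactor x (n + 1) j i') :
    numFactors x n + T.card ≤ numFactors x (n + 1) := by
  refine ncard_range_add_card_le (u := factor x (n + 1)) (v := factor x n)
    (finite_range_factor _ _) ?_ T ?_ ?_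
  · intro i j h
    exact factor_eq_iff.2 ((factor_eq_iff.1 h).mono (by omega))
  · exact fun i hi j hj h => hT i hi j hj (factor_eq_iff.1 h)
  · intro i hi
    obtain ⟨j, hj, hj'⟩ := hred i hi
    exact ⟨j, factor_eq_iff.2 hj, fun i' hi' h => hj' i' hi' (factor_eq_iff.1 h)⟩

theorem numFactors_add_card_le_left (T : Finset ℤ)
    (hT : ∀ i ∈ T, ∀ j ∈ T, SameFactor x (n + 1) (i - 1) (j - 1) → i = j)
    (hred : ∀ i ∈ T, ∃ j, SameFactor x n j i ∧
      ∀ i' ∈ T, ¬ SameFactor x (n + 1) (j - 1) (i' - 1)) :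
    numFactors x n + T.card ≤ numFactors x (n + 1) := by
  have hr : Set.range (fun i => factor x (n + 1) (i - 1)) = Set.range (factor x (n + 1)) := by
    ext w
    exact ⟨fun ⟨i, hi⟩ => ⟨i - 1, hi⟩, fun ⟨i, hi⟩ => ⟨i + 1, by simpa using hi⟩⟩
  unfold numFactors
  rw [← hr]
  refine ncard_range_add_card_le (u := fun i => factor x (n + 1) (i - 1)) (v := factor x n)
    (Set.toFinite _) ?_ T ?_ ?_
  · intro i j h
    have := (factor_eq_iff.1 h).tail
    exact factor_eq_iff.2 (by simpa using this)
  · exact fun i hi j hj h => hT i hi j hj (factor_eq_iff.1 h)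
  · intro i hi
    obtain ⟨j, hj, hj'⟩ := hred i hi
    exact ⟨j, factor_eq_iff.2 hj, fun i' hi' h => hj' i' hi' (factor_eq_iff.1 h)⟩

/-- Each right special factor has at least one more extension than needed to cover it, and distinct
factors have disjoint sets of extensions. -/
theorem numFactors_add_three_le_of_rightSpecial {a b c : ℤ}
    (ha : RightSpecial x n a) (hb : RightSpecial x n b) (hc : RightSpecial x n c)
    (hab : ¬ SameFactor x n a b) (hac : ¬ SameFactor x n a c) (hbc : ¬ SameFactor x n b c) :
    numFactors x n + 3 ≤ numFactors x (n + 1) := by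
  classical
  have hne : ∀ {i j : ℤ}, ¬ SameFactor x n i j → i ≠ j := by
    rintro i j h rfl; exact h (SameFactor.refl _)
  have hcard : ({a, b, c} : Finset ℤ).card = 3 := by
    rw [Finset.card_eq_three]
    exact ⟨a, b, c, hne hab, hne hac, hne hbc, rfl⟩
  rw [← hcard]
  have hiff : ∀ i ∈ ({a, b, c} : Finset ℤ), ∀ j ∈ ({a, b, c} : Finset ℤ),
      SameFactor x n i j → i = j := by
    have h1 := fun h => hab (SameFactor.symm h)
    have h2 := fun h => hac (SameFactor.symm h)
    have h3 := fun h => hbc (SameFactor.symm h)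
    simp only [Finset.mem_insert, Finset.mem_singleton]
    rintro i (rfl | rfl | rfl) j (rfl | rfl | rfl) h <;>
      (first
        | rfl | exact (hab h).elim | exact (hac h).elim | exact (hbc h).elim
        | exact (h1 h).elim | exact (h2 h).elim | exact (h3 h).elim)
  refine numFactors_add_card_le_right _ (fun i hi j hj h => hiff i hi j hj h.head) ?_
  intro i hi
  have hs : RightSpecial x n i := by
    simp only [Finset.mem_insert, Finset.mem_singleton] at hi
    rcases hi with rfl | rfl | rfl <;> assumption
  obtain ⟨j, hj, hj'⟩ := hs
  refine ⟨j, hj, fun i' hi' h => ?_⟩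
  obtain rfl := hiff i hi i' hi' (hj.symm.trans h.head)
  exact hj' h.last

/-- A factor with three followers contributes two to the growth, and another right special factor
contributes one. -/
theorem numFactors_add_three_le_of_three_followers {a b c d : ℤ}
    (hab : SameFactor x n b a) (hac : SameFactor x n c a) (h1 : x (b + n) ≠ x (a + n))
    (h2 : x (c + n) ≠ x (a + n)) (h3 : x (b + n) ≠ x (c + n)) (hd : RightSpecial x n d)
    (had : ¬ SameFactor x n a d) : numFactors x n + 3 ≤ numFactors x (n + 1) := by
  classical
  obtain ⟨d', hd1, hd2⟩ := hd
  have hbc : b ≠ c := by rintro rfl; exact h3 rfl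
  have hbd : b ≠ d := by rintro rfl; exact had hab.symm
  have hcd : c ≠ d := by rintro rfl; exact had hac.symm
  have hcard : ({b, c, d} : Finset ℤ).card = 3 := by
    rw [Finset.card_eq_three]
    exact ⟨b, c, d, hbc, hbd, hcd, rfl⟩
  rw [← hcard]
  refine numFactors_add_card_le_right _ ?_ ?_
  · simp only [Finset.mem_insert, Finset.mem_singleton]
    rintro i (rfl | rfl | rfl) j (rfl | rfl | rfl) h
    · rfl
    · exact absurd h.last h3
    · exact absurd (hab.symm.trans h.head) had
    · exact absurd h.last.symm h3
    · rfl
    · exact absurd (hac.symm.trans h.head) had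
    · exact absurd (hab.symm.trans h.head.symm) had
    · exact absurd (hac.symm.trans h.head.symm) had
    · rfl
  · simp only [Finset.mem_insert, Finset.mem_singleton]
    rintro i (rfl | rfl | rfl)
    · refine ⟨a, hab.symm, ?_⟩
      rintro i' (rfl | rfl | rfl) h
      · exact h1 h.last.symm
      · exact h2 h.last.symm
      · exact had h.head
    · refine ⟨a, hac.symm, ?_⟩
      rintro i' (rfl | rfl | rfl) h
      · exact h1 h.last.symm
      · exact h2 h.last.symm
      · exact had h.head
    · refine ⟨d', hd1, ?_⟩
      rintro i' (rfl | rfl | rfl) h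
      · exact had (hab.symm.trans (h.head.symm.trans hd1))
      · exact had (hac.symm.trans (h.head.symm.trans hd1))
      · exact hd2 h.last

/-- The count of extensions to the left: the factor of length `n + 1` that extends position `i`
starts at `i - 1`. -/
theorem numFactors_add_three_le_of_leftSpecial {a b c : ℤ}
    (ha : LeftSpecial x n a) (hb : LeftSpecial x n b) (hc : LeftSpecial x n c)
    (hab : ¬ SameFactor x n a b) (hac : ¬ SameFactor x n a c) (hbc : ¬ SameFactor x n b c) :
    numFactors x n + 3 ≤ numFactors x (n + 1) := by
  classical
  have hne : ∀ {i j : ℤ}, ¬ SameFactor x n i j → i ≠ j := by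
    rintro i j h rfl; exact h (SameFactor.refl _)
  have hcard : ({a, b, c} : Finset ℤ).card = 3 := by
    rw [Finset.card_eq_three]
    exact ⟨a, b, c, hne hab, hne hac, hne hbc, rfl⟩
  have htail : ∀ {i j : ℤ}, SameFactor x (n + 1) (i - 1) (j - 1) → SameFactor x n i j := by
    intro i j h
    simpa using h.tail
  rw [← hcard]
  have hiff : ∀ i ∈ ({a, b, c} : Finset ℤ), ∀ j ∈ ({a, b, c} : Finset ℤ),
      SameFactor x n i j → i = j := by
    have h1 := fun h => hab (SameFactor.symm h)
    have h2 := fun h => hac (SameFactor.symm h)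
    have h3 := fun h => hbc (SameFactor.symm h)
    simp only [Finset.mem_insert, Finset.mem_singleton]
    rintro i (rfl | rfl | rfl) j (rfl | rfl | rfl) h <;>
      (first
        | rfl | exact (hab h).elim | exact (hac h).elim | exact (hbc h).elim
        | exact (h1 h).elim | exact (h2 h).elim | exact (h3 h).elim)
  refine numFactors_add_card_le_left _ (fun i hi j hj h => hiff i hi j hj (htail h)) ?_
  intro i hi
  have hs : LeftSpecial x n i := by
    simp only [Finset.mem_insert, Finset.mem_singleton] at hi
    rcases hi with rfl | rfl | rfl <;> assumption
  obtain ⟨j, hj, hj'⟩ := hs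
  refine ⟨j, hj, fun i' hi' h => ?_⟩
  obtain rfl := hiff i hi i' hi' (hj.symm.trans (htail h))
  exact hj' h.first

theorem numFactors_add_three_le_of_three_predecessors {a b c d : ℤ}
    (hab : SameFactor x n b a) (hac : SameFactor x n c a) (h1 : x (b - 1) ≠ x (a - 1))
    (h2 : x (c - 1) ≠ x (a - 1)) (h3 : x (b - 1) ≠ x (c - 1)) (hd : LeftSpecial x n d)
    (had : ¬ SameFactor x n a d) : numFactors x n + 3 ≤ numFactors x (n + 1) := by
  classical
  obtain ⟨d', hd1, hd2⟩ := hd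
  have hbc : b ≠ c := by rintro rfl; exact h3 rfl
  have hbd : b ≠ d := by rintro rfl; exact had hab.symm
  have hcd : c ≠ d := by rintro rfl; exact had hac.symm
  have hcard : ({b, c, d} : Finset ℤ).card = 3 := by
    rw [Finset.card_eq_three]
    exact ⟨b, c, d, hbc, hbd, hcd, rfl⟩
  have htail : ∀ {i j : ℤ}, SameFactor x (n + 1) (i - 1) (j - 1) → SameFactor x n i j := by
    intro i j h
    simpa using h.tail
  rw [← hcard]
  refine numFactors_add_card_le_left _ ?_ ?_
  · simp only [Finset.mem_insert, Finset.mem_singleton]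
    rintro i (rfl | rfl | rfl) j (rfl | rfl | rfl) h
    · rfl
    · exact absurd h.first h3
    · exact absurd (hab.symm.trans (htail h)) had
    · exact absurd h.first.symm h3
    · rfl
    · exact absurd (hac.symm.trans (htail h)) had
    · exact absurd (hab.symm.trans (htail h).symm) had
    · exact absurd (hac.symm.trans (htail h).symm) had
    · rfl
  · simp only [Finset.mem_insert, Finset.mem_singleton]
    rintro i (rfl | rfl | rfl)
    · refine ⟨a, hab.symm, ?_⟩
      rintro i' (rfl | rfl | rfl) h
      · exact h1 h.first.symm
      · exact h2 h.first.symm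
      · exact had (htail h)
    · refine ⟨a, hac.symm, ?_⟩
      rintro i' (rfl | rfl | rfl) h
      · exact h1 h.first.symm
      · exact h2 h.first.symm
      · exact had (htail h)
    · refine ⟨d', hd1, ?_⟩
      rintro i' (rfl | rfl | rfl) h
      · exact had (hab.symm.trans ((htail h).symm.trans hd1))
      · exact had (hac.symm.trans ((htail h).symm.trans hd1))
      · exact hd2 h.first

/-- If the number of factors grows by at least three from length `n` to length `n + 1`, then
outside two prescribed classes of factors of length `n + 1` there is still a pair of factors that
differ in the last letter only. -/
theorem exists_sameFactor_of_numFactors_add_three_le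
    (h : numFactors x n + 3 ≤ numFactors x (n + 1)) (a b : ℤ) :
    ∃ i j, SameFactor x n i j ∧ x (i + n) ≠ x (j + n) ∧
      (¬ SameFactor x (n + 1) i a ∧ ¬ SameFactor x (n + 1) i b) ∧
      (¬ SameFactor x (n + 1) j a ∧ ¬ SameFactor x (n + 1) j b) := by
  classical
  by_contra hcon
  push Not at hcon
  set S : Set (Fin (n + 1) → B) :=
    Set.range (factor x (n + 1)) \ {factor x (n + 1) a, factor x (n + 1) b} with hS
  set τ : (Fin (n + 1) → B) → (Fin n → B) := fun w k => w k.castSucc with hτ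
  -- Without the desired pair, dropping the last letter is injective off the two prescribed factors,
  -- so the growth is at most two.
  have hτf : ∀ i, τ (factor x (n + 1) i) = factor x n i := by
    intro i; funext k; simp [hτ, factor]
  have hinj : Set.InjOn τ S := by
    rintro _ ⟨⟨i, rfl⟩, hi⟩ _ ⟨⟨j, rfl⟩, hj⟩ hij
    rw [hτf, hτf, factor_eq_iff] at hij
    simp only [Set.mem_insert_iff, Set.mem_singleton_iff, factor_eq_iff, not_or] at hi hj
    rw [factor_eq_iff]
    by_contra hne
    exact hj.2 (hcon i j hij (fun h => hne (hij.extend_right h)) hi hj.1)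
  have h1 : S.ncard ≤ numFactors x n := by
    rw [← Set.InjOn.ncard_image hinj]
    refine Set.ncard_le_ncard ?_ (finite_range_factor x n)
    rintro _ ⟨_, ⟨⟨i, rfl⟩, -⟩, rfl⟩
    exact ⟨i, (hτf i).symm⟩
  have h2 : numFactors x (n + 1) ≤ S.ncard + 2 := by
    have h3 : Set.range (factor x (n + 1)) ⊆
        S ∪ {factor x (n + 1) a, factor x (n + 1) b} := by
      rw [hS, Set.sdiff_union_self]; exact Set.subset_union_left
    refine (Set.ncard_le_ncard h3 (Set.toFinite _)).trans ((Set.ncard_union_le _ _).trans ?_)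
    gcongr
    exact (Set.ncard_insert_le _ _).trans (by simp)
  omega

/-- Pigeonhole principle for factors. -/
theorem exists_sameFactor_of_numFactors_lt (i : ℤ) :
    ∃ a b, i ≤ a ∧ a < b ∧ b ≤ i + numFactors x n ∧ SameFactor x n a b := by
  by_contra hcon
  push Not at hcon
  have := card_le_numFactors (x := x) (n := n) (Finset.Icc i (i + numFactors x n)) (by
    intro a ha b hb hab
    rw [Finset.mem_Icc] at ha hb
    rcases lt_trichotomy a b with h | h | h
    · exact absurd hab (hcon a b ha.1 h hb.2)
    · exact h
    · exact absurd hab.symm (hcon b a hb.1 h ha.2))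
  rw [Int.card_Icc] at this
  omega

end Counting

/-! ### Loops in the graph of factors, their exits and entries -/

/-- Every factor of `x` occurs in `x` arbitrarily far to the right. -/
def RightRecurrent {B : Type*} (x : ℤ → B) : Prop :=
  ∀ (n : ℕ) (i N : ℤ), ∃ j, N ≤ j ∧ SameFactor x n j i

/-- A simple closed path in the graph of factors of length `n`, traced by the positions
`pos, …, pos + len`. -/
structure Loop {B : Type*} (x : ℤ → B) (n : ℕ) where
  pos : ℤ
  len : ℤ
  len_pos : 0 < len
  same : SameFactor x n pos (pos + len)
  simple : ∀ a b, pos ≤ a → a < b → b < pos + len → ¬ SameFactor x n a b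

namespace Loop

variable {B : Type*} {x : ℤ → B} {n : ℕ} {s t : ℤ}

/-- The factor of length `n` at position `t` lies on the loop `C`. -/
def On (C : Loop x n) (t : ℤ) : Prop :=
  ∃ k, 0 ≤ k ∧ k < C.len ∧ SameFactor x n t (C.pos + k)

/-- The sequence leaves the loop `C` after position `t`. -/
def Exit (C : Loop x n) (t : ℤ) : Prop := C.On t ∧ ¬ C.On (t + 1)

/-- The sequence enters the loop `C` at position `t`. -/
def Entry (C : Loop x n) (t : ℤ) : Prop := C.On t ∧ ¬ C.On (t - 1)

theorem On.congr {C : Loop x n} (ht : C.On t) (h : SameFactor x n s t) : C.On s := by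
  obtain ⟨k, h0, h1, h2⟩ := ht
  exact ⟨k, h0, h1, h.trans h2⟩

theorem on_pos_add (C : Loop x n) {k : ℤ} (h0 : 0 ≤ k) (h1 : k ≤ C.len) : C.On (C.pos + k) := by
  rcases h1.lt_or_eq with h1 | rfl
  · exact ⟨k, h0, h1, SameFactor.refl _⟩
  · exact ⟨0, le_rfl, C.len_pos, by simpa using C.same.symm⟩

theorem On.next {C : Loop x n} (ht : C.On t) :
    ∃ k, 0 ≤ k ∧ k < C.len ∧ SameFactor x n t (C.pos + k) ∧ C.On (C.pos + k + 1) := by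
  obtain ⟨k, h0, h1, h2⟩ := ht
  exact ⟨k, h0, h1, h2, by rw [add_assoc]; exact C.on_pos_add (by omega) (by omega)⟩

theorem On.prev {C : Loop x n} (ht : C.On t) :
    ∃ k, 0 < k ∧ k ≤ C.len ∧ SameFactor x n t (C.pos + k) ∧ C.On (C.pos + k - 1) := by
  obtain ⟨k, h0, h1, h2⟩ := ht
  rcases h0.lt_or_eq with h0 | rfl
  · exact ⟨k, h0, h1.le, h2, by rw [add_sub_assoc]; exact C.on_pos_add (by omega) (by omega)⟩
  · refine ⟨C.len, C.len_pos, le_rfl, h2.trans (by simpa using C.same), ?_⟩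
    rw [add_sub_assoc]
    have := C.len_pos
    exact C.on_pos_add (by omega) (by omega)

/-- One follower continues around the loop, and the letter read at `t` leaves it. -/
theorem Exit.rightSpecial {C : Loop x n} (h : C.Exit t) : RightSpecial x n t := by
  obtain ⟨k, h0, h1, h2, h3⟩ := h.1.next
  refine ⟨C.pos + k, h2.symm, fun h' => h.2 ?_⟩
  exact h3.congr (h2.symm.extend_right h').symm.tail

theorem Entry.leftSpecial {C : Loop x n} (h : C.Entry t) : LeftSpecial x n t := by
  obtain ⟨k, h0, h1, h2, h3⟩ := h.1.prev
  refine ⟨C.pos + k, h2.symm, fun h' => h.2 ?_⟩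
  exact h3.congr (h2.symm.extend_left h').symm.head

theorem On.exists_exit {C : Loop x n} (ht : C.On t) (hs : ¬ C.On s) (hts : t < s) :
    ∃ e, t ≤ e ∧ e < s ∧ C.Exit e ∧ ∀ u, t ≤ u → u ≤ e → C.On u := by
  classical
  have hex : ∃ k : ℕ, ¬ C.On (t + k) := ⟨(s - t).toNat, by
    rwa [Int.toNat_of_nonneg (by omega), show t + (s - t) = s by ring]⟩
  have hk := Nat.find_spec hex
  have hmin := fun m => Nat.find_min hex (m := m)
  have hle := Nat.find_min' hex (m := (s - t).toNat) (by
    rwa [Int.toNat_of_nonneg (by omega), show t + (s - t) = s by ring])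
  set k := Nat.find hex
  have hk0 : k ≠ 0 := by
    intro h
    rw [h] at hk
    simp [ht] at hk
  have hall : ∀ u, t ≤ u → u ≤ t + k - 1 → C.On u := by
    intro u h1 h2
    have := hmin (u - t).toNat (by omega)
    rw [Int.toNat_of_nonneg (by omega), show t + (u - t) = u by ring] at this
    exact not_not.1 this
  refine ⟨t + k - 1, by omega, by omega, ⟨hall _ (by omega) le_rfl, ?_⟩, hall⟩
  rwa [show t + (k : ℤ) - 1 + 1 = t + k by ring]

theorem On.exists_entry {C : Loop x n} (ht : C.On t) (hs : ¬ C.On s) (hts : s < t) :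
    ∃ g, s < g ∧ g ≤ t ∧ C.Entry g ∧ ∀ u, g ≤ u → u ≤ t → C.On u := by
  classical
  have hex : ∃ k : ℕ, ¬ C.On (t - k) := ⟨(t - s).toNat, by
    rwa [Int.toNat_of_nonneg (by omega), show t - (t - s) = s by ring]⟩
  have hk := Nat.find_spec hex
  have hmin := fun m => Nat.find_min hex (m := m)
  have hle := Nat.find_min' hex (m := (t - s).toNat) (by
    rwa [Int.toNat_of_nonneg (by omega), show t - (t - s) = s by ring])
  set k := Nat.find hex
  have hk0 : k ≠ 0 := by
    intro h
    rw [h] at hk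
    simp [ht] at hk
  have hall : ∀ u, t - k + 1 ≤ u → u ≤ t → C.On u := by
    intro u h1 h2
    have := hmin (t - u).toNat (by omega)
    rw [Int.toNat_of_nonneg (by omega), show t - (t - u) = u by ring] at this
    exact not_not.1 this
  refine ⟨t - k + 1, by omega, by omega, ⟨hall _ le_rfl (by omega), ?_⟩, hall⟩
  rwa [show t - (k : ℤ) + 1 - 1 = t - k by ring]

/-- A stretch of positions longer than the number of factors contains a loop. -/
theorem exists_of_stretch [Finite B] (i : ℤ) :
    ∃ C : Loop x n, i ≤ C.pos ∧ C.pos + C.len ≤ i + numFactors x n := by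
  classical
  -- The least gap between equal factors in the stretch gives a closed path without inner
  -- repetition.
  have hex : ∃ m : ℕ, 0 < m ∧ ∃ a, i ≤ a ∧ a + m ≤ i + numFactors x n ∧
      SameFactor x n a (a + m) := by
    obtain ⟨a, b, h1, h2, h3, h4⟩ := exists_sameFactor_of_numFactors_lt (x := x) (n := n) i
    refine ⟨(b - a).toNat, by omega, a, h1, ?_, ?_⟩
    · rw [Int.toNat_of_nonneg (by omega)]; omega
    · rwa [Int.toNat_of_nonneg (by omega), show a + (b - a) = b by ring]
  obtain ⟨h0, a, h1, h2, h3⟩ := Nat.find_spec hex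
  have hmin := fun m => Nat.find_min hex (m := m)
  set m := Nat.find hex
  refine ⟨⟨a, m, by exact_mod_cast h0, h3, ?_⟩, h1, h2⟩
  intro b c hb hbc hc h
  refine hmin (c - b).toNat (by omega) ⟨by omega, b, by omega, ?_, ?_⟩
  · rw [Int.toNat_of_nonneg (by omega)]; omega
  · rwa [Int.toNat_of_nonneg (by omega), show b + (c - b) = c by ring]

/-- From the exit `e` of `C`, the sequence travels for `D` steps outside both loops and then enters
`H`. -/
structure Bridge (C H : Loop x n) (e D : ℤ) : Prop where
  pos : 0 < D
  exit : C.Exit e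
  entry : H.Entry (e + D)
  off : ∀ k, 0 < k → k < D → ¬ C.On (e + k) ∧ ¬ H.On (e + k)

section TwoExits

variable [Finite B] {C H : Loop x n} {e e' : ℤ}

/-- The exits of the disjoint loops are two different right special factors; a third would make the
growth three. -/
theorem rightSpecial_cases (hdis : ∀ t, C.On t → ¬ H.On t)
    (hP : numFactors x (n + 1) ≤ numFactors x n + 2) (he : C.Exit e) (he' : H.Exit e')
    (ht : RightSpecial x n t) : SameFactor x n t e ∨ SameFactor x n t e' := by
  by_contra hcon
  push Not at hcon
  have := numFactors_add_three_le_of_rightSpecial ht he.rightSpecial he'.rightSpecial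
    hcon.1 hcon.2 (fun h => hdis _ he.1 (he'.1.congr h))
  omega

/-- A second way out of `C` would give the exit factor three followers: two that leave and one along
the loop. The exit of `H` adds one more to the growth. -/
theorem Exit.unique (hdis : ∀ t, C.On t → ¬ H.On t)
    (hP : numFactors x (n + 1) ≤ numFactors x n + 2) (he : C.Exit e) (he' : H.Exit e')
    (ht : C.Exit t) : SameFactor x (n + 1) t e := by
  have h1 : SameFactor x n t e := by
    rcases rightSpecial_cases hdis hP he he' ht.rightSpecial with h | h
    · exact h
    · exact absurd (he'.1.congr h) (hdis _ ht.1)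
  by_contra hne
  obtain ⟨k, h0, hk, h2, h3⟩ := he.1.next
  have := numFactors_add_three_le_of_three_followers (a := e) (b := t) (c := C.pos + k)
    (d := e') h1 h2.symm (fun h => hne (h1.extend_right h))
    (fun h => he.2 (h3.congr (h2.symm.extend_right h).symm.tail))
    (fun h => ht.2 (h3.congr ((h1.trans h2).extend_right h).tail))
    he'.rightSpecial (fun h => hdis _ he.1 (he'.1.congr h))
  omega

theorem On.stay (hdis : ∀ t, C.On t → ¬ H.On t)
    (hP : numFactors x (n + 1) ≤ numFactors x n + 2) (he : C.Exit e) (he' : H.Exit e')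
    (hs : C.On s) (hs1 : C.On (s + 1)) (ht1 : C.On (t + 1)) (hst : SameFactor x n s t) :
    SameFactor x (n + 1) s t := by
  by_contra hne
  have h1 : SameFactor x n s e := by
    rcases rightSpecial_cases hdis hP he he'
      (⟨t, hst.symm, fun h => hne (hst.symm.extend_right h).symm⟩ : RightSpecial x n s) with h | h
    · exact h
    · exact absurd (he'.1.congr h) (hdis _ hs)
  have h2 : SameFactor x n t e := hst.symm.trans h1
  have := numFactors_add_three_le_of_three_followers (a := e) (b := s) (c := t)
    (d := e') h1 h2
    (fun h => he.2 (hs1.congr (h1.extend_right h).symm.tail))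
    (fun h => he.2 (ht1.congr (h2.extend_right h).symm.tail))
    (fun h => hne (hst.extend_right h))
    he'.rightSpecial (fun h => hdis _ he.1 (he'.1.congr h))
  omega

/-- Take the first time after `e` at which either loop is met. If that loop were `C`, everything
after `e` would stay on `C` and this one detour, and `H` would never recur. -/
theorem Exit.exists_bridge (hdis : ∀ t, C.On t → ¬ H.On t)
    (hP : numFactors x (n + 1) ≤ numFactors x n + 2) (hrec : RightRecurrent x)
    (he : C.Exit e) (he' : H.Exit e') : ∃ D, Bridge C H e D := by
  classical
  have hfar : ∀ N, ∃ j, N ≤ j ∧ H.On j := by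
    intro N
    obtain ⟨j, hj, hj'⟩ := hrec n H.pos N
    refine ⟨j, hj, (H.on_pos_add le_rfl H.len_pos.le).congr (by simpa using hj')⟩
  have hex : ∃ k : ℕ, 0 < k ∧ (C.On (e + k) ∨ H.On (e + k)) := by
    obtain ⟨j, hj, hj'⟩ := hfar (e + 1)
    refine ⟨(j - e).toNat, by omega, Or.inr ?_⟩
    rwa [Int.toNat_of_nonneg (by omega), show e + (j - e) = j by ring]
  obtain ⟨hD0, hD⟩ := Nat.find_spec hex
  have hmin := fun m => Nat.find_min hex (m := m)
  set D := Nat.find hex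
  have hoff : ∀ k, 0 < k → k < (D : ℤ) → ¬ C.On (e + k) ∧ ¬ H.On (e + k) := by
    intro k h0 h1
    have := hmin k.toNat (by omega)
    rw [Int.toNat_of_nonneg h0.le] at this
    push Not at this
    exact this (by omega)
  have hHD : H.On (e + D) := by
    rcases hD with hC | hH
    swap
    · exact hH
    exfalso
    -- The exit determines its follower by `Exit.unique`, and no factor on the detour is right
    -- special, so this set of factors is closed under moving right.
    have key : ∀ t, e ≤ t →
        C.On t ∨ ∃ k, 0 < k ∧ k < (D : ℤ) ∧ SameFactor x n t (e + k) := by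
      intro t ht
      induction t, ht using Int.leInduction with
      | base => exact Or.inl he.1
      | succ t ht ih =>
        have step : ∀ k, 0 ≤ k → k < (D : ℤ) → SameFactor x (n + 1) t (e + k) →
            C.On (t + 1) ∨ ∃ k, 0 < k ∧ k < (D : ℤ) ∧ SameFactor x n (t + 1) (e + k) := by
          intro k h0 h1 h2
          rcases (show k + 1 ≤ D by omega).lt_or_eq with h | h
          · exact Or.inr ⟨k + 1, by omega, h, by simpa [add_assoc] using h2.tail⟩
          · refine Or.inl (hC.congr ?_)
            have := h2.tail
            rwa [add_assoc, h] at this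
        rcases ih with ih | ⟨k, h0, h1, h2⟩
        · by_cases h : C.On (t + 1)
          · exact Or.inl h
          · refine step 0 le_rfl (by omega) ?_
            simpa using Exit.unique hdis hP he he' ⟨ih, h⟩
        · refine step k h0.le h1 (h2.succ_of_not_rightSpecial fun hr => ?_)
          rcases rightSpecial_cases hdis hP he he' hr with h | h
          · exact (hoff k h0 h1).1 (he.1.congr h)
          · exact (hoff k h0 h1).2 (he'.1.congr h)
    obtain ⟨j, hj, hj'⟩ := hfar e
    rcases key j hj with h | ⟨k, h0, h1, h2⟩
    · exact hdis _ h hj'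
    · exact (hoff k h0 h1).2 (hj'.congr h2.symm)
  refine ⟨D, by omega, he, ⟨hHD, ?_⟩, hoff⟩
  rcases (show 1 ≤ D by omega).lt_or_eq with h | h
  · rw [add_sub_assoc]; exact (hoff (D - 1) (by omega) (by omega)).2
  · rw [← h]; simpa using hdis _ he.1

end TwoExits

end Loop

/-! ### Graphs made of two loops and two connecting paths -/

/-- The graph of factors of length `n` consists of two disjoint loops, `C` through factors that
satisfy `p` and `H` through factors that satisfy `q`, and two paths that connect them. -/
structure LoopPair {B : Type*} (x : ℤ → B) (n : ℕ) (p q : ℤ → Prop) where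
  C : Loop x n
  H : Loop x n
  e : ℤ
  e' : ℤ
  D : ℤ
  D' : ℤ
  onC : ∀ t, C.On t → p t
  onH : ∀ t, H.On t → q t
  disjoint : ∀ t, p t → ¬ q t
  growth : numFactors x (n + 1) ≤ numFactors x n + 2
  recurrent : RightRecurrent x
  bridge : Loop.Bridge C H e D
  bridge' : Loop.Bridge H C e' D'

namespace LoopPair

variable {B : Type*} {x : ℤ → B} {n : ℕ} {p q : ℤ → Prop} {s t : ℤ}

/-- The same pair of loops, listed in the other order. -/
def swap (Λ : LoopPair x n p q) : LoopPair x n q p where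
  C := Λ.H
  H := Λ.C
  e := Λ.e'
  e' := Λ.e
  D := Λ.D'
  D' := Λ.D
  onC := Λ.onH
  onH := Λ.onC
  disjoint := fun t hq hp => Λ.disjoint t hp hq
  growth := Λ.growth
  recurrent := Λ.recurrent
  bridge := Λ.bridge'
  bridge' := Λ.bridge

theorem not_onH (Λ : LoopPair x n p q) (h : Λ.C.On t) : ¬ Λ.H.On t :=
  fun h' => Λ.disjoint t (Λ.onC t h) (Λ.onH t h')

variable [Finite B]

theorem rightSpecial_cases (Λ : LoopPair x n p q) (ht : RightSpecial x n t) :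
    SameFactor x n t Λ.e ∨ SameFactor x n t Λ.e' :=
  Loop.rightSpecial_cases (fun _ => Λ.not_onH) Λ.growth Λ.bridge.exit Λ.bridge'.exit ht

theorem exit_unique (Λ : LoopPair x n p q) (ht : Λ.C.Exit t) : SameFactor x (n + 1) t Λ.e :=
  Loop.Exit.unique (fun _ => Λ.not_onH) Λ.growth Λ.bridge.exit Λ.bridge'.exit ht

theorem stay (Λ : LoopPair x n p q) (hs : Λ.C.On s) (hs1 : Λ.C.On (s + 1))
    (ht1 : Λ.C.On (t + 1)) (hst : SameFactor x n s t) : SameFactor x (n + 1) s t :=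
  Loop.On.stay (fun _ => Λ.not_onH) Λ.growth Λ.bridge.exit Λ.bridge'.exit hs hs1 ht1 hst

/-- The same growth bound, counted to the left: the two entries already use it up. -/
theorem leftSpecial_cases (Λ : LoopPair x n p q) (ht : LeftSpecial x n t) :
    SameFactor x n t (Λ.e + Λ.D) ∨ SameFactor x n t (Λ.e' + Λ.D') := by
  by_contra hcon
  push Not at hcon
  have := numFactors_add_three_le_of_leftSpecial ht Λ.bridge.entry.leftSpecial
    Λ.bridge'.entry.leftSpecial hcon.1 hcon.2
    (fun h => Λ.not_onH Λ.bridge'.entry.1 (Λ.bridge.entry.1.congr h.symm))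
  have := Λ.growth
  omega

theorem entry_unique (Λ : LoopPair x n p q) (ht : Λ.H.Entry t) :
    SameFactor x (n + 1) (t - 1) (Λ.e + Λ.D - 1) := by
  have he := Λ.bridge.entry
  have h1 : SameFactor x n t (Λ.e + Λ.D) := by
    rcases Λ.leftSpecial_cases ht.leftSpecial with h | h
    · exact h
    · exact absurd ht.1 (Λ.not_onH (Λ.bridge'.entry.1.congr h))
  by_contra hne
  obtain ⟨k, h0, hk, h2, h3⟩ := he.1.prev
  have := numFactors_add_three_le_of_three_predecessors (a := Λ.e + Λ.D) (b := t)
    (c := Λ.H.pos + k) (d := Λ.e' + Λ.D') h1 h2.symm (fun h => hne (h1.extend_left h))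
    (fun h => he.2 (h3.congr (h2.symm.extend_left h).symm.head))
    (fun h => ht.2 (h3.congr ((h1.trans h2).extend_left h).head))
    Λ.bridge'.entry.leftSpecial
    (fun h => Λ.not_onH Λ.bridge'.entry.1 (he.1.congr h.symm))
  have := Λ.growth
  omega

theorem not_rightSpecial_of_off (Λ : LoopPair x n p q) (h1 : ¬ Λ.C.On t) (h2 : ¬ Λ.H.On t) :
    ¬ RightSpecial x n t := by
  intro h
  rcases Λ.rightSpecial_cases h with h | h
  · exact h1 (Λ.bridge.exit.1.congr h)
  · exact h2 (Λ.bridge'.exit.1.congr h)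

theorem not_leftSpecial_of_off (Λ : LoopPair x n p q) (h1 : ¬ Λ.C.On t) (h2 : ¬ Λ.H.On t) :
    ¬ LeftSpecial x n t := by
  intro h
  rcases Λ.leftSpecial_cases h with h | h
  · exact h2 (Λ.bridge.entry.1.congr h)
  · exact h1 (Λ.bridge'.entry.1.congr h)

/-- Inside the connecting path, factors determine their successors. -/
theorem bridge_step (Λ : LoopPair x n p q) {k : ℤ} (h0 : 0 < k) (hk : k < Λ.D)
    (h : SameFactor x n t (Λ.e + k)) : SameFactor x (n + 1) t (Λ.e + k) :=
  h.succ_of_not_rightSpecial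
    (Λ.not_rightSpecial_of_off (Λ.bridge.off k h0 hk).1 (Λ.bridge.off k h0 hk).2)

theorem bridge_follow (Λ : LoopPair x n p q) {k : ℤ} (h0 : 0 < k)
    (h : SameFactor x n t (Λ.e + k)) {m : ℤ} (hkm : k ≤ m) (hm : m ≤ Λ.D) :
    SameFactor x n (t + (m - k)) (Λ.e + m) := by
  induction m, hkm using Int.leInduction with
  | base => simpa using h
  | succ m hkm ih =>
    have := (Λ.bridge_step (by omega) (by omega) (ih (by omega))).tail
    rwa [show t + (m + 1 - k) = t + (m - k) + 1 by ring, ← add_assoc]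

/-- Every position lies on one of the loops or on one of the connecting paths. -/
theorem location (Λ : LoopPair x n p q) (t : ℤ) :
    Λ.C.On t ∨ Λ.H.On t ∨ (∃ k, 0 < k ∧ k < Λ.D ∧ SameFactor x n t (Λ.e + k)) ∨
      ∃ k, 0 < k ∧ k < Λ.D' ∧ SameFactor x n t (Λ.e' + k) := by
  suffices key : ∀ t, Λ.e ≤ t → Λ.C.On t ∨ Λ.H.On t ∨
      (∃ k, 0 < k ∧ k < Λ.D ∧ SameFactor x n t (Λ.e + k)) ∨
      ∃ k, 0 < k ∧ k < Λ.D' ∧ SameFactor x n t (Λ.e' + k) by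
    obtain ⟨j, hj, hjt⟩ := Λ.recurrent n t Λ.e
    rcases key j hj with h | h | ⟨k, h0, h1, h2⟩ | ⟨k, h0, h1, h2⟩
    · exact Or.inl (h.congr hjt.symm)
    · exact Or.inr (Or.inl (h.congr hjt.symm))
    · exact Or.inr (Or.inr (Or.inl ⟨k, h0, h1, hjt.symm.trans h2⟩))
    · exact Or.inr (Or.inr (Or.inr ⟨k, h0, h1, hjt.symm.trans h2⟩))
  intro t ht
  induction t, ht using Int.leInduction with
  | base => exact Or.inl Λ.bridge.exit.1
  | succ t ht ih =>
    have aux : ∀ {p q : ℤ → Prop} (Λ : LoopPair x n p q) (k : ℤ), 0 ≤ k → k < Λ.D →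
        SameFactor x (n + 1) t (Λ.e + k) → Λ.H.On (t + 1) ∨
        ∃ k, 0 < k ∧ k < Λ.D ∧ SameFactor x n (t + 1) (Λ.e + k) := by
      intro p q Λ k h0 h1 h2
      have h3 : SameFactor x n (t + 1) (Λ.e + (k + 1)) := by simpa [add_assoc] using h2.tail
      rcases (show k + 1 ≤ Λ.D by omega).lt_or_eq with h | h
      · exact Or.inr ⟨k + 1, by omega, h, h3⟩
      · rw [h] at h3
        exact Or.inl (Λ.bridge.entry.1.congr h3)
    have hD := Λ.bridge.pos
    have hD' := Λ.bridge'.pos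
    have step := aux Λ
    have step' := aux Λ.swap
    simp only [swap] at step'
    rcases ih with h | h | ⟨k, h0, h1, h2⟩ | ⟨k, h0, h1, h2⟩
    · by_cases h' : Λ.C.On (t + 1)
      · exact Or.inl h'
      · have := step 0 le_rfl hD (by simpa using Λ.exit_unique ⟨h, h'⟩)
        exact this.elim (fun a => Or.inr (Or.inl a)) (fun a => Or.inr (Or.inr (Or.inl a)))
    · by_cases h' : Λ.H.On (t + 1)
      · exact Or.inr (Or.inl h')
      · have := step' 0 le_rfl hD' (by simpa [swap] using Λ.swap.exit_unique ⟨h, h'⟩)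
        exact this.elim Or.inl (fun a => Or.inr (Or.inr (Or.inr a)))
    · have := step k h0.le h1 (Λ.bridge_step h0 h1 h2)
      exact this.elim (fun a => Or.inr (Or.inl a)) (fun a => Or.inr (Or.inr (Or.inl a)))
    · have := step' k h0.le h1 (Λ.swap.bridge_step h0 h1 h2)
      exact this.elim Or.inl (fun a => Or.inr (Or.inr (Or.inr a)))

/-- A position whose factor is not the one right after an exit is reached along a loop or along a
connecting path. -/
theorem location_step (Λ : LoopPair x n p q) (h : ¬ SameFactor x n t (Λ.e + 1))
    (h' : ¬ SameFactor x n t (Λ.e' + 1)) :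
    (Λ.C.On (t - 1) ∧ Λ.C.On t) ∨ (Λ.H.On (t - 1) ∧ Λ.H.On t) ∨
      (∃ k, 2 ≤ k ∧ k ≤ Λ.D ∧ SameFactor x (n + 1) (t - 1) (Λ.e + k - 1)) ∨
      ∃ k, 2 ≤ k ∧ k ≤ Λ.D' ∧ SameFactor x (n + 1) (t - 1) (Λ.e' + k - 1) := by
  rcases Λ.location (t - 1) with h1 | h1 | ⟨k, h0, h1, h2⟩ | ⟨k, h0, h1, h2⟩
  · refine Or.inl ⟨h1, ?_⟩
    by_contra h2
    have := (Λ.exit_unique (t := t - 1) ⟨h1, by simpa using h2⟩).tail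
    exact h (by simpa using this)
  · refine Or.inr (Or.inl ⟨h1, ?_⟩)
    by_contra h2
    have := (Λ.swap.exit_unique (t := t - 1) ⟨h1, by simpa [swap] using h2⟩).tail
    exact h' (by simpa [swap] using this)
  · refine Or.inr (Or.inr (Or.inl ⟨k + 1, by omega, by omega, ?_⟩))
    rw [← add_assoc, add_sub_cancel_right]
    exact Λ.bridge_step h0 h1 h2
  · refine Or.inr (Or.inr (Or.inr ⟨k + 1, by omega, by omega, ?_⟩))
    rw [← add_assoc, add_sub_cancel_right]
    exact Λ.swap.bridge_step h0 h1 h2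

/-- Inside the connecting path, factors determine their predecessors. -/
theorem bridge_back (Λ : LoopPair x n p q) {k m : ℤ} (hk : k < Λ.D) (hm0 : 0 ≤ m) (hmk : m ≤ k)
    (h : SameFactor x n t (Λ.e + k)) : SameFactor x n (t - m) (Λ.e + k - m) := by
  induction m, hm0 using Int.leInduction with
  | base => simpa using h
  | succ m hm ih =>
    have hoff := Λ.bridge.off (k - m) (by omega) (by omega)
    rw [← add_sub_assoc] at hoff
    have := ((ih (by omega)).pred_of_not_leftSpecial
      (Λ.not_leftSpecial_of_off hoff.1 hoff.2)).head
    rwa [sub_sub, sub_sub] at this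

theorem bridge_simple (Λ : LoopPair x n p q) {k m : ℤ} (hk : 0 < k) (hkm : k < m) (hm : m < Λ.D) :
    ¬ SameFactor x n (Λ.e + k) (Λ.e + m) := by
  intro h
  have h1 := Λ.bridge_back (by omega) hk.le le_rfl h.symm
  rw [add_sub_cancel_right, add_sub_assoc] at h1
  exact (Λ.bridge.off (m - k) (by omega) (by omega)).1 (Λ.bridge.exit.1.congr h1)

/-- Predecessors are determined inside a path. Following a common factor back to the nearer start
would put the exit of one loop inside the other path or on the other loop. -/
theorem bridge_disjoint (Λ : LoopPair x n p q) {k m : ℤ} (hk : 0 < k) (hkD : k < Λ.D) (hm : 0 < m)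
    (hmD : m < Λ.D') : ¬ SameFactor x n (Λ.e + k) (Λ.e' + m) := by
  suffices key : ∀ {p q : ℤ → Prop} (Λ : LoopPair x n p q) {k m : ℤ}, 0 < k → k < Λ.D → k ≤ m →
      m < Λ.D' → ¬ SameFactor x n (Λ.e' + m) (Λ.e + k) by
    intro h
    rcases le_total k m with hkm | hkm
    · exact key Λ hk hkD hkm hmD h.symm
    · exact key Λ.swap hm hmD hkm hkD h
  intro p q Λ k m hk hkD hkm hmD h
  have h1 := Λ.bridge_back hkD hk.le le_rfl h
  rw [add_sub_cancel_right, add_sub_assoc] at h1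
  have h2 := Λ.bridge.exit.1.congr h1
  rcases hkm.lt_or_eq with hlt | heq
  · exact (Λ.bridge'.off (m - k) (by omega) (by omega)).2 h2
  · rw [heq, sub_self, add_zero] at h2
    exact Λ.not_onH h2 Λ.bridge'.exit.1

/-- The vertices of the loops and the `D - 1` and `D' - 1` interior vertices of the paths are
pairwise different. -/
theorem card_add_le_numFactors (Λ : LoopPair x n p q) :
    Λ.C.len + Λ.H.len + Λ.D + Λ.D' ≤ numFactors x n + 2 := by
  classical
  set T₁ := Finset.Ico Λ.C.pos (Λ.C.pos + Λ.C.len)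
  set T₂ := Finset.Ico Λ.H.pos (Λ.H.pos + Λ.H.len)
  set T₃ := Finset.Ioo Λ.e (Λ.e + Λ.D)
  set T₄ := Finset.Ioo Λ.e' (Λ.e' + Λ.D')
  have on₁ : ∀ t ∈ T₁, Λ.C.On t := by
    intro t ht
    rw [Finset.mem_Ico] at ht
    have := Λ.C.on_pos_add (k := t - Λ.C.pos) (by omega) (by omega)
    rwa [show Λ.C.pos + (t - Λ.C.pos) = t by ring] at this
  have on₂ : ∀ t ∈ T₂, Λ.H.On t := by
    intro t ht
    rw [Finset.mem_Ico] at ht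
    have := Λ.H.on_pos_add (k := t - Λ.H.pos) (by omega) (by omega)
    rwa [show Λ.H.pos + (t - Λ.H.pos) = t by ring] at this
  have off₃ : ∀ t ∈ T₃, ¬ Λ.C.On t ∧ ¬ Λ.H.On t := by
    intro t ht
    rw [Finset.mem_Ioo] at ht
    have := Λ.bridge.off (t - Λ.e) (by omega) (by omega)
    rwa [show Λ.e + (t - Λ.e) = t by ring] at this
  have off₄ : ∀ t ∈ T₄, ¬ Λ.C.On t ∧ ¬ Λ.H.On t := by
    intro t ht
    rw [Finset.mem_Ioo] at ht
    have := Λ.bridge'.off (t - Λ.e') (by omega) (by omega)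
    rw [show Λ.e' + (t - Λ.e') = t by ring] at this
    exact this.symm
  have n12 : ∀ a ∈ T₁, ∀ b ∈ T₂, ¬ SameFactor x n a b := fun a ha b hb h =>
    Λ.not_onH (on₁ a ha) ((on₂ b hb).congr h)
  have n13 : ∀ a ∈ T₁, ∀ b ∈ T₃, ¬ SameFactor x n a b := fun a ha b hb h =>
    (off₃ b hb).1 ((on₁ a ha).congr h.symm)
  have n14 : ∀ a ∈ T₁, ∀ b ∈ T₄, ¬ SameFactor x n a b := fun a ha b hb h =>
    (off₄ b hb).1 ((on₁ a ha).congr h.symm)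
  have n23 : ∀ a ∈ T₂, ∀ b ∈ T₃, ¬ SameFactor x n a b := fun a ha b hb h =>
    (off₃ b hb).2 ((on₂ a ha).congr h.symm)
  have n24 : ∀ a ∈ T₂, ∀ b ∈ T₄, ¬ SameFactor x n a b := fun a ha b hb h =>
    (off₄ b hb).2 ((on₂ a ha).congr h.symm)
  have n34 : ∀ a ∈ T₃, ∀ b ∈ T₄, ¬ SameFactor x n a b := by
    intro a ha b hb h
    rw [Finset.mem_Ioo] at ha hb
    have := Λ.bridge_disjoint (k := a - Λ.e) (m := b - Λ.e') (by omega) (by omega) (by omega)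
      (by omega)
    rw [show Λ.e + (a - Λ.e) = a by ring, show Λ.e' + (b - Λ.e') = b by ring] at this
    exact this h
  have inj : ∀ T : Finset ℤ, (∀ a ∈ T, ∀ b ∈ T, a < b → ¬ SameFactor x n a b) →
      ∀ a ∈ T, ∀ b ∈ T, SameFactor x n a b → a = b := by
    intro T hT a ha b hb h
    rcases lt_trichotomy a b with hab | hab | hab
    · exact absurd h (hT a ha b hb hab)
    · exact hab
    · exact absurd h.symm (hT b hb a ha hab)
  have union : ∀ S T : Finset ℤ, (∀ a ∈ S, ∀ b ∈ S, SameFactor x n a b → a = b) →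
      (∀ a ∈ T, ∀ b ∈ T, SameFactor x n a b → a = b) →
      (∀ a ∈ S, ∀ b ∈ T, ¬ SameFactor x n a b) →
      (∀ a ∈ S ∪ T, ∀ b ∈ S ∪ T, SameFactor x n a b → a = b) ∧
        (S ∪ T).card = S.card + T.card := by
    intro S T hS hT hST
    constructor
    · intro a ha b hb h
      rcases Finset.mem_union.1 ha with ha | ha <;> rcases Finset.mem_union.1 hb with hb | hb
      · exact hS a ha b hb h
      · exact absurd h (hST a ha b hb)
      · exact absurd h.symm (hST b hb a ha)
      · exact hT a ha b hb h
    · refine Finset.card_union_of_disjoint (Finset.disjoint_left.2 fun a ha hb => ?_)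
      exact hST a ha a hb (SameFactor.refl a)
  have i1 := inj T₁ (by
    intro a ha b hb hab
    rw [Finset.mem_Ico] at ha hb
    exact Λ.C.simple a b ha.1 hab hb.2)
  have i2 := inj T₂ (by
    intro a ha b hb hab
    rw [Finset.mem_Ico] at ha hb
    exact Λ.H.simple a b ha.1 hab hb.2)
  have i3 := inj T₃ (by
    intro a ha b hb hab
    rw [Finset.mem_Ioo] at ha hb
    have := Λ.bridge_simple (k := a - Λ.e) (m := b - Λ.e) (by omega) (by omega) (by omega)
    rwa [show Λ.e + (a - Λ.e) = a by ring, show Λ.e + (b - Λ.e) = b by ring] at this)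
  have i4 := inj T₄ (by
    intro a ha b hb hab
    rw [Finset.mem_Ioo] at ha hb
    have := Λ.swap.bridge_simple (k := a - Λ.e') (m := b - Λ.e') (by omega) (by omega)
      (by simp only [swap]; omega)
    simp only [swap] at this
    rwa [show Λ.e' + (a - Λ.e') = a by ring, show Λ.e' + (b - Λ.e') = b by ring] at this)
  have u34 := union T₃ T₄ i3 i4 n34
  have u234 := union T₂ (T₃ ∪ T₄) i2 u34.1 (by
    intro a ha b hb
    rcases Finset.mem_union.1 hb with hb | hb
    exacts [n23 a ha b hb, n24 a ha b hb])
  have u := union T₁ (T₂ ∪ (T₃ ∪ T₄)) i1 u234.1 (by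
    intro a ha b hb
    rcases Finset.mem_union.1 hb with hb | hb
    · exact n12 a ha b hb
    rcases Finset.mem_union.1 hb with hb | hb
    exacts [n13 a ha b hb, n14 a ha b hb])
  have hle := card_le_numFactors _ u.1
  rw [u.2, u234.2, u34.2] at hle
  simp only [T₁, T₂, T₃, T₄, Int.card_Ico, Int.card_Ioo] at hle
  have := Λ.C.len_pos
  have := Λ.H.len_pos
  have := Λ.bridge.pos
  have := Λ.bridge'.pos
  omega

/-- Long stretches of positions that satisfy `p` and of positions that satisfy `q` produce a pair of
loops. -/
theorem nonempty_of_stretches (hrec : RightRecurrent x)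
    (hP : numFactors x (n + 1) ≤ numFactors x n + 2)
    (hp : ∀ s t, SameFactor x n s t → p t → p s) (hq : ∀ s t, SameFactor x n s t → q t → q s)
    (hdis : ∀ t, p t → ¬ q t)
    (hpi : ∃ i : ℤ, ∀ t, i ≤ t → t ≤ i + numFactors x n → p t)
    (hqi : ∃ i : ℤ, ∀ t, i ≤ t → t ≤ i + numFactors x n → q t) :
    Nonempty (LoopPair x n p q) := by
  obtain ⟨i, hi⟩ := hpi
  obtain ⟨j, hj⟩ := hqi
  obtain ⟨C, hC1, hC2⟩ := Loop.exists_of_stretch (x := x) (n := n) i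
  obtain ⟨H, hH1, hH2⟩ := Loop.exists_of_stretch (x := x) (n := n) j
  have onC : ∀ t, C.On t → p t := by
    rintro t ⟨k, h0, h1, h2⟩
    exact hp _ _ h2 (hi _ (by omega) (by omega))
  have onH : ∀ t, H.On t → q t := by
    rintro t ⟨k, h0, h1, h2⟩
    exact hq _ _ h2 (hj _ (by omega) (by omega))
  have hd : ∀ t, C.On t → ¬ H.On t := fun t h h' => hdis t (onC t h) (onH t h')
  have hd' : ∀ t, H.On t → ¬ C.On t := fun t h h' => hd t h' h
  have far : ∀ (L : Loop x n) N, ∃ j, N < j ∧ L.On j := by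
    intro L N
    obtain ⟨j, hj, hj'⟩ := hrec n L.pos (N + 1)
    exact ⟨j, by omega, (L.on_pos_add le_rfl L.len_pos.le).congr (by simpa using hj')⟩
  have exits : ∀ L L' : Loop x n, (∀ t, L'.On t → ¬ L.On t) → ∃ e, L.Exit e := by
    intro L L' h
    obtain ⟨s, hs, hs'⟩ := far L' L.pos
    have h0 : L.On L.pos := by simpa using L.on_pos_add le_rfl L.len_pos.le
    obtain ⟨e, -, -, he, -⟩ := h0.exists_exit (h s hs') hs
    exact ⟨e, he⟩
  obtain ⟨e, he⟩ := exits C H hd'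
  obtain ⟨e', he'⟩ := exits H C hd
  obtain ⟨D, hD⟩ := Loop.Exit.exists_bridge hd hP hrec he he'
  obtain ⟨D', hD'⟩ := Loop.Exit.exists_bridge hd' hP hrec he' he
  exact ⟨⟨C, H, e, e', D, D', onC, onH, hdis, hP, hrec, hD, hD'⟩⟩

end LoopPair

/-! ### Bispecial factors in a pair of loops -/

/-- Factors of length `n` that satisfy `p` and factors of length `n` that satisfy `q` have no common
factor of length `K`. -/
def NoOverlap {B : Type*} (x : ℤ → B) (n K : ℕ) (p q : ℤ → Prop) : Prop :=
  ∀ i j a b : ℤ, p i → q j → 0 ≤ a → a + K ≤ n → 0 ≤ b → b + K ≤ n → ¬ SameFactor x K (i + a) (j + b)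

namespace NoOverlap

variable {B : Type*} {x : ℤ → B} {n K : ℕ} {p q : ℤ → Prop}

theorem swap (h : NoOverlap x n K p q) : NoOverlap x n K q p :=
  fun i j a b hi hj ha ha' hb hb' hs => h j i b a hj hi hb hb' ha ha' hs.symm

theorem absurd_of_sameFactor (h : NoOverlap x n K p q) {i j s t : ℤ} (hi : p i) (hj : q j)
    (his : i ≤ s) (hsi : s + K ≤ i + n) (hjt : j ≤ t) (htj : t + K ≤ j + n)
    (hs : SameFactor x K s t) : False := by
  refine h i j (s - i) (t - j) hi hj (by omega) (by omega) (by omega) (by omega) ?_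
  rwa [show i + (s - i) = s by ring, show j + (t - j) = t by ring]

end NoOverlap

theorem SameFactor.apply {B : Type*} {x : ℤ → B} {n : ℕ} {i j : ℤ} (h : SameFactor x n i j)
    {s t : ℤ} (hst : s - i = t - j) (h0 : i ≤ s) (h1 : s < i + n) : x s = x t := by
  have := h (s - i) (by omega) (by omega)
  rwa [show i + (s - i) = s by ring, hst, show j + (t - j) = t by ring] at this

theorem SameFactor.sub_apply {B : Type*} {x : ℤ → B} {n m : ℕ} {i j : ℤ} (h : SameFactor x n i j)
    {s t : ℤ} (hst : s - i = t - j) (h0 : i ≤ s) (h1 : s + m ≤ i + n) : SameFactor x m s t := by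
  intro u hu0 hu1
  exact h.apply (by omega) (by omega) (by omega)

namespace Loop

variable {B : Type*} {x : ℤ → B} {n : ℕ} {s t : ℤ} {C : Loop x n}

/-- The closing equality of the loop makes every factor on it periodic with period `C.len`. -/
theorem On.periodic (ht : C.On t) (h0 : t ≤ s) (h1 : s + C.len < t + n) :
    x s = x (s + C.len) := by
  obtain ⟨k, hk0, hk1, hk⟩ := ht
  rw [hk.apply (t := s - t + C.pos + k) (by ring) h0 (by have := C.len_pos; omega),
    hk.apply (s := s + C.len) (t := s - t + C.pos + k + C.len) (by ring)
      (by have := C.len_pos; omega) h1]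
  exact C.same.apply (by ring) (by omega) (by omega)

/-- If the next letter kept the period, the next factor would still lie on the loop. -/
theorem Exit.break (h : C.Exit t) (hC : C.len < n) : x (t + n) ≠ x (t + n - C.len) := by
  intro heq
  have hl := C.len_pos
  obtain ⟨k, hk0, hk1, hk, hk2⟩ := h.1.next
  refine h.2 (hk2.congr (hk.extend_right ?_).tail)
  rw [heq, hk.apply (t := C.pos + k + n - C.len) (by ring) (by omega) (by omega)]
  exact C.same.apply (by ring) (by omega) (by omega)

theorem Entry.break (h : C.Entry t) (hC : C.len < n) : x (t - 1) ≠ x (t - 1 + C.len) := by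
  intro heq
  have hl := C.len_pos
  obtain ⟨k, hk0, hk1, hk, hk2⟩ := h.1.prev
  refine h.2 (hk2.congr (hk.extend_left ?_).head)
  rw [heq, hk.apply (t := C.pos + k - 1 + C.len) (by ring) (by omega) (by omega)]
  exact (C.same.apply (by ring) (by omega) (by omega)).symm

end Loop

namespace LoopPair

variable {B : Type*} {x : ℤ → B} {p q : ℤ → Prop} {t : ℤ}

/-- On a shorter path, the exit factor and the entry factor would overlap in `K` letters. -/
theorem lt_bridge_len {n K : ℕ} (Λ : LoopPair x n p q) (hK : NoOverlap x n K p q) :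
    (n : ℤ) < Λ.D + K := by
  by_contra hcon
  have := Λ.bridge.pos
  exact hK.absurd_of_sameFactor (Λ.onC _ Λ.bridge.exit.1) (Λ.onH _ Λ.bridge.entry.1)
    (s := Λ.e + Λ.D) (t := Λ.e + Λ.D) (by omega) (by omega) le_rfl (by omega) (SameFactor.refl _)

variable {m K : ℕ} (Λ : LoopPair x (m + 1) p q)

/-- The letters at the two ends of a pair of equal factors of length `m` differ. -/
def _root_.Bispecial {B : Type*} (x : ℤ → B) (m : ℕ) (t t' : ℤ) : Prop :=
  SameFactor x m t t' ∧ x (t - 1) ≠ x (t' - 1) ∧ x (t + m) ≠ x (t' + m)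

theorem _root_.Bispecial.symm {B : Type*} {x : ℤ → B} {m : ℕ} {t t' : ℤ}
    (h : Bispecial x m t t') : Bispecial x m t' t := ⟨h.1.symm, h.2.1.symm, h.2.2.symm⟩

/-- The occurrence on the path must start late enough that the period of the exit factor does not
force equal left letters (`e1`), and must end before it contains `K` letters of the entry factor of
`H` (`e2`). -/
theorem bridge_len_of_loop_bridge (hK : NoOverlap x (m + 1) K p q)
    {k : ℤ} (ht : Λ.C.On (t - 1)) (ht' : Λ.C.On t)
    (hb : Bispecial x m t (Λ.e + k)) (hk : 2 ≤ k) (hkD : k ≤ Λ.D) :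
    2 * (m + 1 : ℤ) < Λ.D + Λ.C.len + K := by
  have hl := Λ.C.len_pos
  obtain ⟨h1, h2, h3⟩ := hb
  have e1 : (m : ℤ) + 1 ≤ k - 1 + Λ.C.len := by
    by_contra hcon
    apply h2
    rw [ht.periodic (s := t - 1) le_rfl (by push_cast; omega),
      Λ.bridge.exit.1.periodic (s := Λ.e + k - 1) (by omega)
        (by push_cast; omega)]
    exact h1.apply (by ring) (by omega) (by omega)
  have e2 : k + m < Λ.D + K := by
    by_contra hcon
    refine hK.absurd_of_sameFactor (Λ.onC _ ht') (Λ.onH _ Λ.bridge.entry.1)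
      (s := t + (Λ.D - k)) (t := Λ.e + Λ.D) (by omega) (by push_cast; omega) le_rfl
      (by push_cast; omega) ?_
    exact h1.sub_apply (by ring) (by omega) (by omega)
  omega

/-- On the path into `C` the roles change: the period of the entry factor would force equal right
letters, and the exit factor of `H` limits how early the occurrence starts. -/
theorem bridge_len_of_loop_bridge' (hK : NoOverlap x (m + 1) K p q) (hKm : K ≤ m)
    {k : ℤ} (ht : Λ.C.On t)
    (hb : Bispecial x m t (Λ.e' + k)) (hk : 2 ≤ k) (hkD : k ≤ Λ.D') :
    2 * (m + 1 : ℤ) < Λ.D' + Λ.C.len + K := by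
  have hl := Λ.C.len_pos
  obtain ⟨h1, h2, h3⟩ := hb
  have e1 : k + m - Λ.C.len < Λ.D' := by
    by_contra hcon
    apply h3
    have h4 := ht.periodic (s := t + m - Λ.C.len) (by omega)
      (by push_cast; omega)
    have h5 := Λ.bridge'.entry.1.periodic (s := Λ.e' + k + m - Λ.C.len)
      (by omega) (by push_cast; omega)
    rw [sub_add_cancel] at h4 h5
    rw [← h4, ← h5]
    exact h1.apply (by ring) (by omega) (by omega)
  have e2 : (m : ℤ) + 1 < k + K := by
    by_contra hcon
    refine hK.absurd_of_sameFactor (Λ.onC _ ht) (Λ.onH _ Λ.bridge'.exit.1)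
      (s := t) (t := Λ.e' + k) (by omega) (by push_cast; omega) (by omega)
      (by push_cast; omega) ?_
    exact h1.mono hKm
  omega

theorem bridge_len_of_bridge_bridge (hK : NoOverlap x (m + 1) K p q)
    (hC : Λ.C.len ≤ m) (hH : Λ.H.len ≤ m) {k k' : ℤ} (hb : Bispecial x m (Λ.e + k) (Λ.e + k'))
    (hk : 2 ≤ k) (hkk' : k < k') (hkD : k' ≤ Λ.D) :
    2 * (m + 1 : ℤ) < Λ.D + Λ.C.len + Λ.H.len + 2 * K := by
  have hl := Λ.C.len_pos
  have hl' := Λ.H.len_pos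
  obtain ⟨h1, h2, h3⟩ := hb
  -- Here the first occurrence shares at most `K` letters with the exit factor. If it reached
  -- `H.len` letters into the entry factor, the break of the period at the entry would be copied to
  -- where the second occurrence lies in the entry factor and the period holds.
  by_cases c1 : (m : ℤ) + 1 ≤ k + K
  · have : k + m < Λ.D + Λ.H.len := by
      by_contra hcon
      apply Λ.bridge.entry.break (by push_cast; omega)
      rw [h1.apply (s := Λ.e + Λ.D - 1) (t := Λ.e + Λ.D - 1 + (k' - k)) (by ring) (by omega)
        (by omega), h1.apply (s := Λ.e + Λ.D - 1 + Λ.H.len)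
        (t := Λ.e + Λ.D - 1 + (k' - k) + Λ.H.len) (by ring) (by omega) (by omega)]
      exact Λ.bridge.entry.1.periodic (by omega) (by push_cast; omega)
    omega
  -- The mirror image: the second occurrence shares at most `K` letters with the entry factor, and
  -- the break at the exit of `C` bounds its start.
  by_cases c2 : k' + m ≤ Λ.D + K
  · have : (m : ℤ) + 1 < k' + Λ.C.len := by
      by_contra hcon
      have hbr := Λ.bridge.exit.break (by push_cast; omega)
      push_cast at hbr
      apply hbr
      rw [h1.symm.apply (s := Λ.e + (m + 1)) (t := Λ.e + (m + 1) - (k' - k)) (by ring) (by omega)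
        (by omega), h1.symm.apply (s := Λ.e + (m + 1) - Λ.C.len)
        (t := Λ.e + (m + 1) - (k' - k) - Λ.C.len) (by ring) (by omega) (by omega)]
      have := Λ.bridge.exit.1.periodic (s := Λ.e + (m + 1) - (k' - k) - Λ.C.len)
         (by omega) (by push_cast; omega)
      rw [this, sub_add_cancel]
    omega
  -- the union of the two occurrences has period `d`
  set d := k' - k with hd
  have hper : ∀ j : ℕ, ∀ s, Λ.e + k ≤ s - j * d → s < Λ.e + k' + m → x (s - j * d) = x s := by
    intro j
    induction j with
    | zero => intro s _ _; simp
    | succ j ih =>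
      intro s hs0 hs1
      push_cast at hs0 ⊢
      have hjd : 0 ≤ (j : ℤ) * d := mul_nonneg (by omega) (by omega)
      have e1 : (j + 1 : ℤ) * d = j * d + d := by ring
      rw [e1] at hs0 ⊢
      rw [← ih s (by omega) hs1]
      exact h1.apply (by omega) (by omega) (by omega)
  -- translate the end into the first period
  set r := (Λ.D - k) / d with hr
  have hmod := Int.emod_add_mul_ediv (Λ.D - k) d
  have hmod0 := Int.emod_nonneg (Λ.D - k) (show d ≠ 0 by omega)
  have hmod1 := Int.emod_lt_of_pos (Λ.D - k) (show 0 < d by omega)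
  have hr0 : 0 ≤ r := Int.ediv_nonneg (by omega) (by omega)
  obtain ⟨j, hj⟩ := Int.eq_ofNat_of_zero_le hr0
  set s₀ := k + (Λ.D - k) % d with hs₀
  have hs₀D : s₀ = Λ.D - j * d := by
    rw [hs₀]
    rw [← hr, hj, mul_comm] at hmod
    omega
  have e1 : (m : ℤ) + 1 < s₀ + K := by
    by_contra hcon
    refine hK.absurd_of_sameFactor (Λ.onC _ Λ.bridge.exit.1) (Λ.onH _ Λ.bridge.entry.1)
      (s := Λ.e + s₀) (t := Λ.e + Λ.D) (by omega) (by push_cast; omega) le_rfl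
      (by push_cast; omega) ?_
    intro u hu0 hu1
    have := hper j (Λ.e + Λ.D + u) (by omega) (by omega)
    rw [← this]
    congr 1
    omega
  -- Otherwise, moving by `j + 1` periods identifies the block of length `K` at `Λ.e + k`, inside
  -- the exit factor, with a block inside the entry factor.
  have e2 : s₀ + m + k' < Λ.D + k' + K := by
    by_contra hcon
    refine hK.absurd_of_sameFactor (Λ.onC _ Λ.bridge.exit.1) (Λ.onH _ Λ.bridge.entry.1)
      (s := Λ.e + k) (t := Λ.e + Λ.D + (k' - s₀)) (by omega) (by push_cast; omega) (by omega)
      (by push_cast; omega) ?_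
    intro u hu0 hu1
    have h4 := hper j (Λ.e + Λ.D + (k' - s₀) + u) (by omega) (by omega)
    rw [← h4, h1.apply (s := Λ.e + k + u) (t := Λ.e + k' + u) (by ring) (by omega) (by omega)]
    congr 1
    omega
  omega

/-- The paths leave opposite loops and reach opposite loops, so the two occurrences cannot both
begin with `K` letters of the exit factors (`c1`) or both end with `K` letters of the entry factors
(`c2`). If one begins in the exit factor of a loop and the other ends in the entry factor of the
same loop, the break of the period at the exit keeps these pieces from overlapping too far. -/
theorem bridge_len_add_of_bridge_bridge' (hK : NoOverlap x (m + 1) K p q) (hKm : K ≤ m)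
    (hC : Λ.C.len ≤ m) (hH : Λ.H.len ≤ m) {k k' : ℤ} (hb : Bispecial x m (Λ.e + k) (Λ.e' + k'))
    (hk : 2 ≤ k) (hkD : k ≤ Λ.D) (hk' : 2 ≤ k') (hkD' : k' ≤ Λ.D') :
    3 * (m + 1 : ℤ) < Λ.D + Λ.D' + Λ.C.len + Λ.H.len + 3 * K := by
  have hl := Λ.C.len_pos
  have hl' := Λ.H.len_pos
  have hD := Λ.lt_bridge_len hK
  have hD' := Λ.swap.lt_bridge_len hK.swap
  simp only [swap] at hD'
  push_cast at hD hD'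
  obtain ⟨h1, h2, h3⟩ := hb
  have c1 : ¬ (k + K ≤ m + 1 ∧ k' + K ≤ m + 1) := by
    rintro ⟨ha, hb⟩
    exact hK.absurd_of_sameFactor (Λ.onC _ Λ.bridge.exit.1) (Λ.onH _ Λ.bridge'.exit.1)
      (s := Λ.e + k) (t := Λ.e' + k') (by omega) (by push_cast; omega) (by omega)
      (by push_cast; omega) (h1.mono hKm)
  have c2 : ¬ (Λ.D + K ≤ k + m ∧ Λ.D' + K ≤ k' + m) := by
    rintro ⟨ha, hb⟩
    refine hK.absurd_of_sameFactor (Λ.onC _ Λ.bridge'.entry.1) (Λ.onH _ Λ.bridge.entry.1)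
      (s := Λ.e' + k' + m - K) (t := Λ.e + k + m - K) (by omega) (by push_cast; omega)
      (by omega) (by push_cast; omega) ?_
    exact h1.symm.sub_apply (by ring) (by omega) (by omega)
  by_cases a : k + K ≤ m + 1
  · by_cases b : Λ.D' + K ≤ k' + m
    · -- a prefix and a suffix of the common factor follow the loop `C`
      have : (m : ℤ) + 1 + (k' - k) - Λ.C.len < Λ.D' := by
        by_contra hcon
        have hbr := Λ.bridge.exit.break (by push_cast; omega)
        push_cast at hbr
        apply hbr
        rw [h1.apply (s := Λ.e + (m + 1)) (t := Λ.e' + (m + 1) + (k' - k)) (by ring)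
          (by omega) (by omega), h1.apply (s := Λ.e + (m + 1) - Λ.C.len)
          (t := Λ.e' + (m + 1) + (k' - k) - Λ.C.len) (by ring) (by omega) (by omega)]
        have := Λ.bridge'.entry.1.periodic (s := Λ.e' + (m + 1) + (k' - k) - Λ.C.len)
           (by omega) (by push_cast; omega)
        rw [this, sub_add_cancel]
      omega
    · omega
  · by_cases b : Λ.D + K ≤ k + m
    · have : (m : ℤ) + 1 + (k - k') - Λ.H.len < Λ.D := by
        by_contra hcon
        have hbr := Λ.bridge'.exit.break (by push_cast; omega)
        push_cast at hbr
        apply hbr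
        rw [h1.symm.apply (s := Λ.e' + (m + 1)) (t := Λ.e + (m + 1) + (k - k')) (by ring)
          (by omega) (by omega), h1.symm.apply (s := Λ.e' + (m + 1) - Λ.H.len)
          (t := Λ.e + (m + 1) + (k - k') - Λ.H.len) (by ring) (by omega) (by omega)]
        have := Λ.bridge.entry.1.periodic (s := Λ.e + (m + 1) + (k - k') - Λ.H.len)
           (by omega) (by push_cast; omega)
        rw [this, sub_add_cancel]
      omega
    · omega

theorem lt_len_add_of_bispecial [Finite B] (hK : NoOverlap x (m + 1) K p q) (hKm : K ≤ m)
    (hC : Λ.C.len ≤ m) (hH : Λ.H.len ≤ m) (hs : numFactors x m + 3 ≤ numFactors x (m + 1)) :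
    3 * (m + 1 : ℤ) < Λ.D + Λ.D' + Λ.C.len + Λ.H.len + 3 * K := by
  have hl := Λ.C.len_pos
  have hl' := Λ.H.len_pos
  have hD := Λ.lt_bridge_len hK
  have hD' := Λ.swap.lt_bridge_len hK.swap
  simp only [swap] at hD'
  push_cast at hD hD'
  -- The first factors after the two exits are excluded, so neither `t` nor `t'` is reached by an
  -- edge that leaves a loop.
  obtain ⟨t, t', htt, hne, ⟨ht1, ht2⟩, ht1', ht2'⟩ :=
    exists_sameFactor_of_numFactors_add_three_le hs (Λ.e + 1) (Λ.e' + 1)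
  -- Equal left letters would make the factor at `t - 1` an exit of a loop with both followers still
  -- on that loop, which `stay` forbids.
  have hb : Bispecial x m t t' := by
    refine ⟨htt, fun heq => ?_, hne⟩
    have h1 : SameFactor x (m + 1) (t - 1) (t' - 1) := htt.extend_left heq
    have hrs : RightSpecial x (m + 1) (t - 1) := by
      refine ⟨t' - 1, h1.symm, fun h => hne ?_⟩
      push_cast at h
      rw [show t' - 1 + ((m : ℤ) + 1) = t' + m by ring,
        show t - 1 + ((m : ℤ) + 1) = t + m by ring] at h
      exact h.symm
    have aux : ∀ {p q : ℤ → Prop} (Λ : LoopPair x (m + 1) p q),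
        SameFactor x (m + 1) (t - 1) Λ.e → ¬ SameFactor x (m + 1) t (Λ.e + 1) →
        ¬ SameFactor x (m + 1) t' (Λ.e + 1) → False := by
      intro p q Λ h2 h3 h3'
      have h2' := h1.symm.trans h2
      have o1 := Λ.bridge.exit.1.congr h2
      have o1' := Λ.bridge.exit.1.congr h2'
      have o2 : Λ.C.On t := by
        by_contra hno
        have := (Λ.exit_unique (t := t - 1) ⟨o1, by simpa using hno⟩).tail
        exact h3 (by simpa using this)
      have o2' : Λ.C.On t' := by
        by_contra hno
        have := (Λ.exit_unique (t := t' - 1) ⟨o1', by simpa using hno⟩).tail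
        exact h3' (by simpa using this)
      have := (Λ.stay o1 (by simpa using o2) (by simpa using o2') h1).last
      apply hne
      push_cast at this
      rwa [show t' - 1 + ((m : ℤ) + 1) = t' + m by ring,
        show t - 1 + ((m : ℤ) + 1) = t + m by ring] at this
    rcases Λ.rightSpecial_cases hrs with h | h
    · exact aux Λ h ht1 ht1'
    · exact aux Λ.swap h ht2 ht2'
  -- replace positions on a connecting path by positions on the standard path
  have move : ∀ {t t' s : ℤ}, Bispecial x m t t' → SameFactor x (m + 1 + 1) (t - 1) (s - 1) →
      Bispecial x m s t' := by
    rintro t t' s ⟨h1, h2, h3⟩ h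
    have h4 : SameFactor x m t s := by simpa using h.tail.head
    refine ⟨h4.symm.trans h1, ?_, ?_⟩
    · rwa [← h.first]
    · rwa [← h.apply (s := t + m) (t := s + m) (by ring) (by omega) (by push_cast; omega)]
  have loops : ∀ {p q : ℤ → Prop} (Λ : LoopPair x (m + 1) p q), Λ.C.len ≤ m → ∀ {t t' : ℤ},
      Bispecial x m t t' → Λ.C.On (t - 1) → Λ.C.On (t' - 1) → False := by
    rintro p q Λ hC t t' ⟨h1, h2, h3⟩ o1 o2
    have hl := Λ.C.len_pos
    apply h2
    rw [o1.periodic (s := t - 1) (by omega) (by push_cast; omega),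
      o2.periodic (s := t' - 1) (by omega) (by push_cast; omega)]
    exact h1.apply (by ring) (by omega) (by omega)
  have cross : ∀ {t t' : ℤ}, Bispecial x m t t' → Λ.C.On t → Λ.H.On t' → False := by
    rintro t t' ⟨h1, h2, h3⟩ o1 o2
    exact hK.absurd_of_sameFactor (Λ.onC _ o1) (Λ.onH _ o2) le_rfl (by push_cast; omega)
      le_rfl (by push_cast; omega) (h1.mono hKm)
  have mixed : ∀ {t t' : ℤ}, Bispecial x m t t' →
      ((Λ.C.On (t - 1) ∧ Λ.C.On t) ∨ (Λ.H.On (t - 1) ∧ Λ.H.On t)) →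
      ((∃ k, 2 ≤ k ∧ k ≤ Λ.D ∧ SameFactor x (m + 1 + 1) (t' - 1) (Λ.e + k - 1)) ∨
      ∃ k, 2 ≤ k ∧ k ≤ Λ.D' ∧ SameFactor x (m + 1 + 1) (t' - 1) (Λ.e' + k - 1)) →
      3 * (m + 1 : ℤ) < Λ.D + Λ.D' + Λ.C.len + Λ.H.len + 3 * K := by
    rintro t t' hb (⟨o1, o2⟩ | ⟨o1, o2⟩) (⟨k, k2, kD, hk⟩ | ⟨k, k2, kD, hk⟩)
    · have := Λ.bridge_len_of_loop_bridge hK o1 o2 (move hb.symm hk).symm k2 kD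
      omega
    · have := Λ.bridge_len_of_loop_bridge' hK hKm o2 (move hb.symm hk).symm k2 kD
      omega
    · have := Λ.swap.bridge_len_of_loop_bridge' hK.swap hKm o2 (move hb.symm hk).symm k2 kD
      simp only [swap] at this
      omega
    · have := Λ.swap.bridge_len_of_loop_bridge hK.swap o1 o2 (move hb.symm hk).symm k2 kD
      simp only [swap] at this
      omega
  have same : ∀ {k k' : ℤ}, Bispecial x m (Λ.e + k) (Λ.e + k') → 2 ≤ k → k < k' → k' ≤ Λ.D →
      3 * (m + 1 : ℤ) < Λ.D + Λ.D' + Λ.C.len + Λ.H.len + 3 * K := by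
    intro k k' hb h1 h2 h3
    have := Λ.bridge_len_of_bridge_bridge hK hC hH hb h1 h2 h3
    omega
  have same' : ∀ {k k' : ℤ}, Bispecial x m (Λ.e' + k) (Λ.e' + k') → 2 ≤ k → k < k' → k' ≤ Λ.D' →
      3 * (m + 1 : ℤ) < Λ.D + Λ.D' + Λ.C.len + Λ.H.len + 3 * K := by
    intro k k' hb h1 h2 h3
    have := Λ.swap.bridge_len_of_bridge_bridge hK.swap hH hC hb h1 h2 h3
    simp only [swap] at this
    omega
  have hns : ∀ {s : ℤ}, ¬ Bispecial x m s s := fun h => h.2.1 rfl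
  rcases Λ.location_step ht1 ht2 with l | l | l | l <;>
    rcases Λ.location_step ht1' ht2' with l' | l' | l' | l'
  · exact (loops Λ hC hb l.1 l'.1).elim
  · exact (cross hb l.2 l'.2).elim
  · exact mixed hb (Or.inl l) (Or.inl l')
  · exact mixed hb (Or.inl l) (Or.inr l')
  · exact (cross hb.symm l'.2 l.2).elim
  · exact (loops Λ.swap hH hb l.1 l'.1).elim
  · exact mixed hb (Or.inr l) (Or.inl l')
  · exact mixed hb (Or.inr l) (Or.inr l')
  · exact mixed hb.symm (Or.inl l') (Or.inl l)
  · exact mixed hb.symm (Or.inr l') (Or.inl l)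
  · obtain ⟨k, h2, hD, hk⟩ := l
    obtain ⟨k', h2', hD', hk'⟩ := l'
    have hb' := (move (move hb hk).symm hk').symm
    rcases lt_trichotomy k k' with h | rfl | h
    · exact same hb' h2 h hD'
    · exact (hns hb').elim
    · exact same hb'.symm h2' h hD
  · obtain ⟨k, h2, hD, hk⟩ := l
    obtain ⟨k', h2', hD', hk'⟩ := l'
    exact Λ.bridge_len_add_of_bridge_bridge' hK hKm hC hH (move (move hb hk).symm hk').symm
      h2 hD h2' hD'
  · exact mixed hb.symm (Or.inl l') (Or.inr l)
  · exact mixed hb.symm (Or.inr l') (Or.inr l)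
  · obtain ⟨k, h2, hD, hk⟩ := l
    obtain ⟨k', h2', hD', hk'⟩ := l'
    exact Λ.bridge_len_add_of_bridge_bridge' hK hKm hC hH (move (move hb hk).symm hk')
      h2' hD' h2 hD
  · obtain ⟨k, h2, hD, hk⟩ := l
    obtain ⟨k', h2', hD', hk'⟩ := l'
    have hb' := (move (move hb hk).symm hk').symm
    rcases lt_trichotomy k k' with h | rfl | h
    · exact same' hb' h2 h hD'
    · exact (hns hb').elim
    · exact same' hb'.symm h2' h hD

/-- If the first difference of the number of factors drops to two at `m + 1`, then the number of
factors of length `m + 1` is close to `3 (m + 1)`. -/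
theorem three_mul_lt_numFactors_add [Finite B] (Λ : LoopPair x (m + 1) p q) (hK : NoOverlap x (m + 1) K p q) (hK3 : 3 ≤ K)
    (hs : numFactors x m + 3 ≤ numFactors x (m + 1)) :
    3 * (m + 1) < numFactors x (m + 1) + 4 * K := by
  by_contra hcon
  have hl := Λ.C.len_pos
  have hl' := Λ.H.len_pos
  have hcard := Λ.card_add_le_numFactors
  have hKm : K ≤ m := by omega
  have hD := Λ.lt_bridge_len hK
  have hD' := Λ.swap.lt_bridge_len hK.swap
  simp only [swap] at hD'
  push_cast at hD hD' hcard
  -- The loops are short: the paths alone take more than `2 (m + 1) - 2 K` of the `numFactors x (m +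
  -- 1) + 2` available.
  have := Λ.lt_len_add_of_bispecial hK hKm (by omega) (by omega) hs
  omega

end LoopPair

/-! ### Maximal runs along a loop -/

namespace Loop

variable {B : Type*} {x : ℤ → B} {n : ℕ} {C : Loop x n}

/-- A maximal stretch of positions on the loop `C`. -/
structure Run (C : Loop x n) (g e : ℤ) : Prop where
  le : g ≤ e
  entry : C.Entry g
  exit : C.Exit e
  on : ∀ u, g ≤ u → u ≤ e → C.On u

theorem Run.periodic {g e s : ℤ} (h : C.Run g e) (hC : C.len < n) (h0 : g ≤ s)
    (h1 : s + C.len < e + n) : x s = x (s + C.len) := by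
  rcases le_total s e with hse | hse
  · exact (h.on s h0 hse).periodic le_rfl (by omega)
  · exact (h.on e h.le le_rfl).periodic hse h1

/-- Both runs have period `C.len < n`, so their first `n` letters determine the rest. -/
theorem Run.agree {g e g' e' : ℤ} (h : C.Run g e) (h' : C.Run g' e') (hC : C.len < n)
    (hs : SameFactor x n g g') {N : ℕ} (hN : g + N ≤ e + n) (hN' : g' + N ≤ e' + n) :
    SameFactor x N g g' := by
  have hl := C.len_pos
  have key : ∀ s : ℕ, s < N → x (g + s) = x (g' + s) := by
    intro s
    induction s using Nat.strong_induction_on with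
    | _ s ih =>
      intro hsN
      by_cases hsn : s < n
      · exact hs s (by omega) (by omega)
      · have h1 := h.periodic hC (s := g + s - C.len) (by omega) (by omega)
        have h2 := h'.periodic hC (s := g' + s - C.len) (by omega) (by omega)
        rw [sub_add_cancel] at h1 h2
        rw [← h1, ← h2]
        have := ih (s - C.len.toNat) (by omega) (by omega)
        rw [Nat.cast_sub (by omega), Int.toNat_of_nonneg hl.le] at this
        rwa [add_sub_assoc, add_sub_assoc]
  intro s h0 h1
  have := key s.toNat (by omega)
  rwa [Int.toNat_of_nonneg h0] at this

theorem On.exists_run {t a b : ℤ} (ht : C.On t) (ha : ¬ C.On a) (hat : a < t) (hb : ¬ C.On b)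
    (htb : t < b) : ∃ g e, a < g ∧ g ≤ t ∧ t ≤ e ∧ e < b ∧ C.Run g e := by
  obtain ⟨e, h1, h2, h3, h4⟩ := ht.exists_exit hb htb
  obtain ⟨g, h5, h6, h7, h8⟩ := ht.exists_entry ha hat
  refine ⟨g, e, h5, h6, h1, h2, ⟨by omega, h7, h3, fun u hu hu' => ?_⟩⟩
  rcases le_total u t with h | h
  exacts [h8 u hu h, h4 u h hu']

end Loop

namespace LoopPair

variable {B : Type*} {x : ℤ → B} {n : ℕ} {p q : ℤ → Prop}

theorem exists_onC_ge (Λ : LoopPair x n p q) (N : ℤ) : ∃ t, N ≤ t ∧ Λ.C.On t := by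
  obtain ⟨j, hj, hj'⟩ := Λ.recurrent n Λ.C.pos N
  exact ⟨j, hj, (Λ.C.on_pos_add le_rfl Λ.C.len_pos.le).congr (by simpa using hj')⟩

theorem exists_not_onC_gt (Λ : LoopPair x n p q) (N : ℤ) : ∃ t, N < t ∧ ¬ Λ.C.On t := by
  obtain ⟨j, hj, hj'⟩ := Λ.swap.exists_onC_ge (N + 1)
  exact ⟨j, by omega, fun h => Λ.not_onH h hj'⟩

theorem exists_run (Λ : LoopPair x n p q) : ∃ g e, Λ.C.Run g e := by
  obtain ⟨t, ht, ht'⟩ := Λ.exists_onC_ge (Λ.e + 2)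
  obtain ⟨s, hs, hs'⟩ := Λ.exists_not_onC_gt t
  obtain ⟨g, e, -, -, -, -, h⟩ := ht'.exists_run Λ.bridge.exit.2 (by omega) hs' hs
  exact ⟨g, e, h⟩

/-- Two runs along the same loop, of sufficiently different lengths, yield two right special factors
that are one letter longer than the shorter run. -/
theorem numFactors_add_three_le_of_runs [Finite B] (Λ : LoopPair x n p q) (hC : Λ.C.len < n)
    {g e g' e' r : ℤ} {N : ℕ} (hN : e - g + n = N) (h : Λ.C.Run g e) (h' : Λ.C.Run g' e')
    (hlong : e - g + 2 * Λ.C.len ≤ e' - g') (hr : RightSpecial x (N + 1) r)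
    (hrg : ¬ SameFactor x N (r + 1) g) (hre : ¬ SameFactor x N (r + 1) (e' + n - N)) :
    numFactors x (N + 1) + 3 ≤ numFactors x (N + 1 + 1) := by
  have hl := Λ.C.len_pos
  have hge := h.le
  -- A loop has only one entry, so the runs also agree in the letter before them.
  have hgg : SameFactor x (n + 1) (g - 1) (g' - 1) :=
    (Λ.swap.entry_unique h.entry).trans (Λ.swap.entry_unique h'.entry).symm
  have hP : SameFactor x N g g' :=
    h.agree h' hC (by simpa using hgg.tail) (by omega) (by omega)
  have hg1 : x (g - 1) = x (g' - 1) := hgg.first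
  have hbr := h.exit.break hC
  have hbr' := h'.exit.break hC
  have hbg := h.entry.break hC
  set f := e' + n - N with hf
  -- After the whole short run the period breaks, while the long run still continues it.
  have r1 : RightSpecial x (N + 1) (g - 1) := by
    refine ⟨g' - 1, (hP.extend_left hg1).symm, fun heq => hbr ?_⟩
    push_cast at heq
    rw [show g - 1 + ((N : ℤ) + 1) = e + n by omega,
      show g' - 1 + ((N : ℤ) + 1) = g' + N - Λ.C.len + Λ.C.len by ring,
      ← h'.periodic hC (by omega) (by omega)] at heq
    rw [← heq]
    exact (hP.apply (by omega) (by omega) (by omega)).symm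
  -- The end of the long run is compared with its own translate by one period, which is not yet
  -- followed by the break.
  have r2 : RightSpecial x (N + 1) (f - 1) := by
    refine ⟨f - 1 - Λ.C.len, ?_, fun heq => hbr' ?_⟩
    · intro s h0 h1
      push_cast at h1
      rw [h'.periodic hC (s := f - 1 - Λ.C.len + s) (by omega) (by omega)]
      congr 1
      ring
    · push_cast at heq
      rw [show f - 1 + ((N : ℤ) + 1) = e' + n by omega,
        show f - 1 - Λ.C.len + ((N : ℤ) + 1) = e' + n - Λ.C.len by omega] at heq
      exact heq.symm
  have hfx : x (f - 1) = x (f - 1 + Λ.C.len) := h'.periodic hC (by omega) (by omega)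
  refine numFactors_add_three_le_of_rightSpecial r1 r2 hr ?_ ?_ ?_
  -- The first letter breaks the period at `g - 1`, but at `f - 1` it lies inside the long run and
  -- keeps it.
  · intro hs
    apply hbg
    rw [hs.first, hfx]
    exact (hs.apply (by ring) (by omega) (by push_cast; omega)).symm
  · intro hs
    exact hrg (by simpa using hs.tail.symm)
  · intro hs
    exact hre (by simpa using hs.tail.symm)

end LoopPair

/-! ### Block sums and windows with means on one side of `γ` -/

/-- The sum of `F` over the letters of `x` at the positions `i, …, i + m - 1`. -/
def blockSum {B : Type*} (F : B → ℝ) (x : ℤ → B) (i : ℤ) (m : ℕ) : ℝ :=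
  ∑ k ∈ Finset.range m, F (x (i + k))

/-- All blocks of length at least `K` in the window of length `n` at `i` have mean larger
than `γ`. -/
def Above {B : Type*} (F : B → ℝ) (γ : ℝ) (x : ℤ → B) (K n : ℕ) (i : ℤ) : Prop :=
  ∀ (a : ℤ) (m : ℕ), K ≤ m → i ≤ a → a + m ≤ i + n → γ * m < blockSum F x a m

section Above

variable {B : Type*} {F : B → ℝ} {γ : ℝ} {x : ℤ → B} {K n : ℕ} {i j : ℤ}

theorem blockSum_add (a : ℤ) (m k : ℕ) :
    blockSum F x a (m + k) = blockSum F x a m + blockSum F x (a + m) k := by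
  simp only [blockSum, Finset.sum_range_add]
  push_cast
  simp only [add_assoc]

theorem blockSum_neg (a : ℤ) (m : ℕ) :
    blockSum (fun b => -F b) x a m = -blockSum F x a m := by
  simp [blockSum]

theorem SameFactor.blockSum_eq {m : ℕ} (h : SameFactor x m i j) :
    blockSum F x i m = blockSum F x j m := by
  refine Finset.sum_congr rfl fun k hk => ?_
  rw [Finset.mem_range] at hk
  rw [h k (by omega) (by omega)]

theorem Above.congr (hj : Above F γ x K n j) (h : SameFactor x n i j) : Above F γ x K n i := by
  intro a m hK h0 h1
  rw [(h.sub_apply (t := a - i + j) (by ring) h0 h1 : SameFactor x m a _).blockSum_eq]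
  exact hj _ m hK (by omega) (by omega)

theorem Above.sub {N : ℕ} (h : Above F γ x K N i) (h0 : i ≤ j) (h1 : j + n ≤ i + N) :
    Above F γ x K n j :=
  fun a m hK h2 h3 => h a m hK (by omega) (by omega)

theorem Above.not_neg (hKn : K ≤ n) (h : Above F γ x K n i) :
    ¬ Above (fun b => -F b) (-γ) x K n i := by
  intro h'
  have h1 := h i n hKn le_rfl le_rfl
  have h2 := h' i n hKn le_rfl le_rfl
  rw [blockSum_neg] at h2
  linarith

/-- A common block of length `K` would have mean both below and above `γ`. -/
theorem noOverlap_above (F : B → ℝ) (γ : ℝ) (x : ℤ → B) (K n : ℕ) :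
    NoOverlap x n K (Above (fun b => -F b) (-γ) x K n) (Above F γ x K n) := by
  intro i j a b hi hj ha ha' hb hb' hs
  have h1 := hi (i + a) K le_rfl (by omega) (by omega)
  have h2 := hj (j + b) K le_rfl (by omega) (by omega)
  rw [blockSum_neg, hs.blockSum_eq] at h1
  linarith

/-- Blocks of length at most `n` lie in one window. From a longer block cut off `K` letters; the
rest still has length at least `K` because `2 * K ≤ n`. -/
theorem above_of_forall_above {g e : ℤ} (hge : g ≤ e) (hK : 0 < K) (hKn : 2 * K ≤ n)
    (h : ∀ t, g ≤ t → t ≤ e → Above F γ x K n t) {a : ℤ} {m : ℕ} (hm : K ≤ m) (ha : g ≤ a)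
    (ham : a + m ≤ e + n) : γ * m < blockSum F x a m := by
  induction m using Nat.strong_induction_on generalizing a with
  | _ m ih =>
    have short : ∀ {a : ℤ} {m : ℕ}, K ≤ m → m ≤ n → g ≤ a → a + m ≤ e + n →
        γ * m < blockSum F x a m := by
      intro a m hm hmn ha ham
      rcases le_total a e with hae | hae
      · exact h a ha hae a m hm le_rfl (by omega)
      · exact h e hge le_rfl a m hm hae ham
    by_cases hmn : m ≤ n
    · exact short hm hmn ha ham
    · have h3 := ih K (by omega) le_rfl ha (by omega)
      have h4 := ih (m - K) (by omega) (by omega) (a := a + K) (by omega) (by omega)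
      have h5 := blockSum_add (F := F) (x := x) a K (m - K)
      rw [Nat.add_sub_cancel' hm] at h5
      rw [h5]
      have h6 : (m : ℝ) = K + (m - K : ℕ) := by
        rw [Nat.cast_sub hm]; ring
      rw [h6]
      linarith

end Above

/-! ### Growth of the number of factors at good scales -/

/-- At the scale `n` the number of factors is small, and there are long windows with small means as
well as long windows with large means of `F`. -/
structure GoodScale {B : Type*} (F : B → ℝ) (γ : ℝ) (x : ℤ → B) (K : ℕ → ℕ) (n : ℕ) : Prop where
  le : numFactors x n + 4 * K n ≤ 3 * n
  two_mul_le : 2 * K n ≤ n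
  three_le : 3 ≤ K n
  above : ∃ i, Above F γ x (K n) (20 * n) i
  below : ∃ i, Above (fun b => -F b) (-γ) x (K n) (20 * n) i

namespace GoodScale

variable {B : Type*} {F : B → ℝ} {γ : ℝ} {x : ℤ → B} {K : ℕ → ℕ} {n : ℕ}

theorem neg (h : GoodScale F γ x K n) : GoodScale (fun b => -F b) (-γ) x K n where
  le := h.le
  two_mul_le := h.two_mul_le
  three_le := h.three_le
  above := h.below
  below := by simpa using h.above

theorem stretch (h : GoodScale F γ x K n) :
    ∃ i : ℤ, ∀ t, i ≤ t → t ≤ i + numFactors x n → Above F γ x (K n) n t := by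
  obtain ⟨i, hi⟩ := h.above
  have := h.le
  exact ⟨i, fun t h0 h1 => hi.sub h0 (by push_cast; omega)⟩

theorem nonempty_loopPair [Finite B] (h : GoodScale F γ x K n) (hrec : RightRecurrent x)
    (hP : numFactors x (n + 1) ≤ numFactors x n + 2) :
    Nonempty (LoopPair x n (Above (fun b => -F b) (-γ) x (K n) n) (Above F γ x (K n) n)) := by
  refine LoopPair.nonempty_of_stretches hrec hP (fun s t h ht => ht.congr h)
    (fun s t h ht => ht.congr h) (fun t h1 h2 => ?_) h.neg.stretch h.stretch
  have := h.two_mul_le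
  exact h2.not_neg (by omega) h1

/-- There is a right special factor with large mean. -/
theorem exists_rightSpecial [Finite B] (h : GoodScale F γ x K n) (hrec : RightRecurrent x) :
    ∃ r, RightSpecial x n r ∧ Above F γ x (K n) n r := by
  obtain ⟨i, hi⟩ := h.stretch
  obtain ⟨j, hj⟩ := h.neg.stretch
  obtain ⟨C, hC1, hC2⟩ := Loop.exists_of_stretch (x := x) (n := n) i
  have onC : ∀ t, C.On t → Above F γ x (K n) n t := by
    rintro t ⟨k, h0, h1, h2⟩
    exact (hi _ (by omega) (by omega)).congr h2
  obtain ⟨s, hs, hs'⟩ := hrec n j (C.pos + 1)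
  have hns : ¬ C.On s := fun hon => (onC s hon).not_neg (by have := h.two_mul_le; omega)
    ((hj j le_rfl (by omega)).congr hs')
  obtain ⟨e, -, -, he, -⟩ := (show C.On C.pos by
    simpa using C.on_pos_add le_rfl C.len_pos.le).exists_exit hns (by omega)
  exact ⟨e, he.rightSpecial, onC e he.1⟩

/-- If the shortest run along one of the loops has length `N`, then there is a run along the same
loop that is much longer. -/
theorem exists_long_run [Finite B] (hn : GoodScale F γ x K n)
    (Λ : LoopPair x n (Above (fun b => -F b) (-γ) x (K n) n) (Above F γ x (K n) n)) {N : ℕ}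
    (hnN : n ≤ N) (hN : GoodScale F γ x K N)
    (hmin : ∀ g e, Λ.H.Run g e → (N : ℤ) ≤ e - g + n) :
    ∃ g e, Λ.C.Run g e ∧ 10 * (N : ℤ) ≤ e - g := by
  have hcard := Λ.card_add_le_numFactors
  have hnle := hn.le
  have hn3 := hn.three_le
  have hn2 := hn.two_mul_le
  have hN3 := hN.three_le
  have hN2 := hN.two_mul_le
  have := Λ.C.len_pos
  have := Λ.H.len_pos
  have := Λ.bridge.pos
  have := Λ.bridge'.pos
  obtain ⟨i₀, hi₀⟩ := hN.below
  obtain ⟨i, hi, hii⟩ := Λ.recurrent (20 * N) i₀ (Λ.e + 2)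
  have hlow := hi₀.congr hii
  -- A run along `H` spans at least `N` letters, so it would put a block of length `N` with large
  -- mean inside the low window.
  have noH : ∀ t, i + 2 * N ≤ t → t ≤ i + 18 * N → ¬ Λ.H.On t := by
    intro t h0 h1 hH
    obtain ⟨s, hs, hs'⟩ := Λ.swap.exists_not_onC_gt t
    obtain ⟨g, e, hg, hgt, hte, -, hrun⟩ := hH.exists_run
      (Λ.not_onH Λ.bridge.exit.1) (by omega) hs' hs
    have hlen := hmin g e hrun
    have h2 := above_of_forall_above (F := F) (γ := γ) (x := x) hrun.le (by omega) hn.two_mul_le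
      (fun u hu hu' => Λ.onH u (hrun.on u hu hu')) (a := min t (e + n - N)) (m := N) (by omega)
      (by omega) (by omega)
    have h3 := hlow (min t (e + n - N)) N (by omega) (by omega) (by push_cast; omega)
    rw [blockSum_neg] at h3
    linarith
  -- Paths have length at most `3 n`. So `C` is met by `i + 5 N`, and since leaving it leads to `H`
  -- within `3 n` steps, the run lasts beyond `i + 15 N`.
  obtain ⟨t₁, h1, h2, h3⟩ : ∃ t₁, i + 2 * N ≤ t₁ ∧ t₁ ≤ i + 2 * N + 3 * n ∧ Λ.C.On t₁ := by
    rcases Λ.location (i + 2 * N) with h | h | ⟨k, k0, k1, hk⟩ | ⟨k, k0, k1, hk⟩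
    · exact ⟨_, le_rfl, by omega, h⟩
    · exact absurd h (noH _ le_rfl (by omega))
    · have := Λ.bridge_follow k0 hk k1.le le_rfl
      exact absurd (Λ.bridge.entry.1.congr this) (noH _ (by omega) (by omega))
    · have := Λ.swap.bridge_follow k0 hk k1.le le_rfl
      exact ⟨_, by omega, by omega, Λ.bridge'.entry.1.congr this⟩
  obtain ⟨s, hs, hs'⟩ := Λ.exists_not_onC_gt t₁
  obtain ⟨g, e, hg, hgt, hte, -, hrun⟩ := h3.exists_run Λ.bridge.exit.2 (by omega) hs' hs
  refine ⟨g, e, hrun, ?_⟩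
  have h4 := Λ.bridge_follow (k := 1) (m := Λ.D) one_pos (Λ.exit_unique hrun.exit).tail
    (by omega) le_rfl
  have h5 := fun h => noH (e + 1 + (Λ.D - 1)) h
  by_contra hcon
  exact noH (e + 1 + (Λ.D - 1)) (by omega) (by omega) (Λ.bridge.entry.1.congr h4)

/-- Above a good scale, the first difference of the number of factors is at least three again. -/
theorem exists_numFactors_add_three_le [Finite B] {n₀ : ℕ} (h : ∀ n, n₀ ≤ n → GoodScale F γ x K n)
    (hn : n₀ ≤ n)
    (Λ : LoopPair x n (Above (fun b => -F b) (-γ) x (K n) n) (Above F γ x (K n) n)) :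
    ∃ m, n ≤ m ∧ numFactors x m + 3 ≤ numFactors x (m + 1) := by
  classical
  -- Negating `F` and exchanging the loops, one may assume that the shortest run is along `C`.
  suffices key : ∀ (F : B → ℝ) (γ : ℝ), (∀ n, n₀ ≤ n → GoodScale F γ x K n) →
      ∀ Λ : LoopPair x n (Above (fun b => -F b) (-γ) x (K n) n) (Above F γ x (K n) n), ∀ k : ℕ,
      (∃ g, Λ.C.Run g (g + k)) → (∀ g e, Λ.H.Run g e → (k : ℤ) ≤ e - g) →
      ∃ m, n ≤ m ∧ numFactors x m + 3 ≤ numFactors x (m + 1) by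
    have hex : ∃ k : ℕ, (∃ g, Λ.C.Run g (g + k)) ∨ ∃ g, Λ.H.Run g (g + k) := by
      obtain ⟨g, e, hr⟩ := Λ.exists_run
      refine ⟨(e - g).toNat, Or.inl ⟨g, ?_⟩⟩
      rwa [Int.toNat_of_nonneg (by have := hr.le; omega), show g + (e - g) = e by ring]
    have hk := Nat.find_spec hex
    have hmin := fun m => Nat.find_min' hex (m := m)
    set k := Nat.find hex
    have hrun : ∀ {L : Loop x n} {g e : ℤ}, L.Run g e → ∃ m : ℕ, (m : ℤ) = e - g ∧
        L.Run g (g + m) := by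
      intro L g e hr
      refine ⟨(e - g).toNat, Int.toNat_of_nonneg (by have := hr.le; omega), ?_⟩
      rwa [Int.toNat_of_nonneg (by have := hr.le; omega), show g + (e - g) = e by ring]
    rcases hk with hk | hk
    · refine key F γ h Λ k hk fun g e hr => ?_
      obtain ⟨m, hm, hm'⟩ := hrun hr
      have := hmin m (Or.inr ⟨g, hm'⟩)
      omega
    · have e1 : (fun b => - -F b) = F := by simp
      have h2 := key (fun b => -F b) (-γ) (fun n hn => (h n hn).neg)
      rw [e1, neg_neg] at h2
      refine h2 Λ.swap k hk fun g e hr => ?_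
      obtain ⟨m, hm, hm'⟩ := hrun hr
      have := hmin m (Or.inl ⟨g, hm'⟩)
      omega
  intro F γ h Λ k hk hmin
  obtain ⟨g, hg⟩ := hk
  have hgn := h n hn
  have hgN := h (k + n) (by omega)
  have hgN1 := h (k + n + 1) (by omega)
  have hcard := Λ.card_add_le_numFactors
  have hnle := hgn.le
  have hn3 := hgn.three_le
  have hNle := hgN1.le
  have hN3 := hgN1.three_le
  have hN2 := hgN1.two_mul_le
  have hn2 := hgn.two_mul_le
  have hl := Λ.C.len_pos
  have hl' := Λ.H.len_pos
  have hKo := noOverlap_above F γ x (K n) n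
  have hD := Λ.lt_bridge_len hKo
  have hD' := Λ.swap.lt_bridge_len hKo.swap
  simp only [LoopPair.swap] at hD'
  obtain ⟨g', e', hrun', hlong⟩ := hgn.exists_long_run Λ (N := k + n) (by omega) hgN
    (fun g e hr => by have := hmin g e hr; push_cast; omega)
  obtain ⟨r, hr, hra⟩ := hgN1.exists_rightSpecial Λ.recurrent
  push_cast at hlong
  -- Blocks inside runs along `C` have small mean, so the right special factor at `r`, with large
  -- mean, differs from the two provided by the runs.
  have hlow : ∀ {g e a : ℤ}, Λ.C.Run g e → g ≤ a → a + (k + n : ℕ) ≤ e + n →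
      ¬ SameFactor x (k + n) (r + 1) a := by
    intro g e a hrun h1 h2 hs
    have h3 := above_of_forall_above hrun.le (by omega) hgn.two_mul_le
      (fun u hu hu' => Λ.onC u (hrun.on u hu hu')) (a := a) (m := k + n) (by omega) h1 h2
    have h4 := hra (r + 1) (k + n) (by omega) (by omega) (by push_cast; omega)
    rw [hs.blockSum_eq] at h4
    rw [blockSum_neg] at h3
    linarith
  refine ⟨k + n + 1, by omega, Λ.numFactors_add_three_le_of_runs (by omega) (g := g)
    (e := g + k) (g' := g') (e' := e') (r := r) (by push_cast; ring) hg hrun' (by omega) hr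
    (hlow hg le_rfl (by push_cast; omega)) (hlow hrun' (by push_cast; omega) (by omega))⟩

end GoodScale

/-- If all large scales are good, then eventually the number of factors grows by at least three at
each step. -/
theorem exists_forall_numFactors_add_three_le {B : Type*} [Finite B] {F : B → ℝ} {γ : ℝ}
    {x : ℤ → B} {K : ℕ → ℕ} {n₀ : ℕ} (hrec : RightRecurrent x)
    (h : ∀ n, n₀ ≤ n → GoodScale F γ x K n) :
    ∃ m, ∀ n, m ≤ n → numFactors x n + 3 ≤ numFactors x (n + 1) := by
  have step : ∀ m, n₀ ≤ m → numFactors x m + 3 ≤ numFactors x (m + 1) →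
      numFactors x (m + 1) + 3 ≤ numFactors x (m + 1 + 1) := by
    intro m hm hs
    by_contra hcon
    have hg := h (m + 1) (by omega)
    obtain ⟨Λ⟩ := hg.nonempty_loopPair hrec (by omega)
    have := Λ.three_mul_lt_numFactors_add (noOverlap_above F γ x _ _) hg.three_le hs
    have := hg.le
    omega
  obtain ⟨m, hm, hs⟩ : ∃ m, n₀ ≤ m ∧ numFactors x m + 3 ≤ numFactors x (m + 1) := by
    by_cases hs : numFactors x n₀ + 3 ≤ numFactors x (n₀ + 1)
    · exact ⟨n₀, le_rfl, hs⟩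
    · obtain ⟨Λ⟩ := (h n₀ le_rfl).nonempty_loopPair hrec (by omega)
      exact GoodScale.exists_numFactors_add_three_le h le_rfl Λ
  refine ⟨m, fun n hn => ?_⟩
  induction n, hn using Nat.le_induction with
  | base => exact hs
  | succ n hn ih => exact step n (by omega) ih

/-! ### From frequencies to good scales -/

section Stretch

variable {B : Type*} [Finite B] {F : B → ℝ} {γ b : ℝ} {x : ℤ → B}

theorem exists_abs_blockSum_le (F : B → ℝ) (x : ℤ → B) :
    ∃ M, ∀ i m, |blockSum F x i m| ≤ M * m := by
  obtain ⟨M, hM⟩ := (Set.finite_range fun b => |F b|).bddAbove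
  refine ⟨M, fun i m => (Finset.abs_sum_le_sum_abs _ _).trans ?_⟩
  refine (Finset.sum_le_sum fun k _ => hM ⟨_, rfl⟩).trans ?_
  simp [mul_comm]

/-- If the means over long blocks exceed a number larger than `γ` in places, then there are long
windows all of whose blocks of proportional length have mean larger than `γ`. -/
theorem eventually_exists_above (hγ : γ < b) (h : ∀ n : ℕ, ∃ i, b * n ≤ blockSum F x i n) {δ : ℝ}
    (hδ : 0 < δ) : ∀ᶠ N : ℕ in atTop, ∃ i : ℤ, ∀ (a : ℤ) (m : ℕ), δ * N ≤ m → i ≤ a →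
      a + m ≤ i + N → γ * m < blockSum F x a m := by
  obtain ⟨M, hM⟩ := exists_abs_blockSum_le F x
  -- The maximal block sums are subadditive, so by Fekete's lemma `u n / n` converges to some `L ≥
  -- b`.
  set u : ℕ → ℝ := fun n => ⨆ i, blockSum F x i n with hu
  have hbdd : ∀ n, BddAbove (Set.range fun i => blockSum F x i n) := fun n =>
    ⟨M * n, by rintro _ ⟨i, rfl⟩; exact (le_abs_self _).trans (hM i n)⟩
  have hle : ∀ i n, blockSum F x i n ≤ u n := fun i n => le_ciSup (hbdd n) i
  have hsub : Subadditive u := by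
    intro m n
    refine ciSup_le fun i => ?_
    rw [blockSum_add]
    exact add_le_add (hle _ _) (hle _ _)
  have hbu : ∀ n : ℕ, b * n ≤ u n := fun n => by
    obtain ⟨i, hi⟩ := h n
    exact hi.trans (hle i n)
  have hbelow : BddBelow (Set.range fun n => u n / n) := by
    refine ⟨min b 0, ?_⟩
    rintro _ ⟨n, rfl⟩
    rcases Nat.eq_zero_or_pos n with rfl | hn
    · simp
    · refine (min_le_left _ _).trans ?_
      rw [le_div_iff₀ (by exact_mod_cast hn)]
      exact hbu n
  have hlim := hsub.tendsto_lim hbelow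
  set L := hsub.lim with hL
  have hLu : ∀ n : ℕ, L * n ≤ u n := by
    intro n
    rcases Nat.eq_zero_or_pos n with rfl | hn
    · simpa using hbu 0
    · have := hsub.lim_le_div hbelow hn.ne'
      rwa [le_div_iff₀ (by exact_mod_cast hn)] at this
  have hbL : b ≤ L := by
    refine ge_of_tendsto hlim ?_
    filter_upwards [eventually_gt_atTop 0] with n hn
    rw [le_div_iff₀ (by exact_mod_cast hn)]
    exact hbu n
  set ε := δ * (b - γ) / 4 with hε
  have hε0 : 0 < ε := by have := sub_pos.2 hγ; positivity
  obtain ⟨C, hC0, hC⟩ : ∃ C, 0 ≤ C ∧ ∀ n : ℕ, u n ≤ (L + ε) * n + C := by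
    obtain ⟨l, hl⟩ := eventually_atTop.1 (hlim.eventually_lt_const (show L < L + ε by linarith))
    refine ⟨∑ k ∈ Finset.range (l + 1), |u k - (L + ε) * k|,
      Finset.sum_nonneg fun _ _ => abs_nonneg _, fun n => ?_⟩
    by_cases hn : n < l + 1
    · have := Finset.single_le_sum (f := fun k : ℕ => |u k - (L + ε) * k|)
        (fun _ _ => abs_nonneg _) (Finset.mem_range.2 hn)
      have := le_abs_self (u n - (L + ε) * n)
      linarith
    · have h1 := hl n (by omega)
      rw [div_lt_iff₀ (by exact_mod_cast (by omega : 0 < n))] at h1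
      have : 0 ≤ ∑ k ∈ Finset.range (l + 1), |u k - (L + ε) * k| :=
        Finset.sum_nonneg fun _ _ => abs_nonneg _
      linarith
  have hgrow : ∀ᶠ N : ℕ in atTop, 1 + 2 * C < (b - γ) / 4 * (δ * N) := by
    have : Tendsto (fun N : ℕ => (b - γ) / 4 * (δ * N)) atTop atTop :=
      (tendsto_natCast_atTop_atTop.const_mul_atTop hδ).const_mul_atTop
        (by have := sub_pos.2 hγ; positivity)
    exact this.eventually_gt_atTop _
  filter_upwards [hgrow] with N hN
  -- In a nearly maximal window the parts beside a block have mean at most about `L + ε`, so the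
  -- block has sum at least `L * m - ε * N - 1 - 2 * C`. The choices of `ε` and `N` make each of the
  -- two errors at most `(b - γ) / 4 * m`.
  obtain ⟨i, hi⟩ : ∃ i, u N - 1 < blockSum F x i N :=
    exists_lt_of_lt_ciSup (by change u N - 1 < u N; linarith)
  refine ⟨i, fun a m hm h0 h1 => ?_⟩
  obtain ⟨p, hp⟩ := Int.eq_ofNat_of_zero_le (show 0 ≤ a - i by omega)
  obtain ⟨s, hs⟩ := Int.eq_ofNat_of_zero_le (show 0 ≤ i + N - (a + m) by omega)
  have hNeq : N = p + (m + s) := by omega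
  have hsplit : blockSum F x i N =
      blockSum F x i p + (blockSum F x a m + blockSum F x (a + m) s) := by
    rw [hNeq, blockSum_add, blockSum_add, show i + (p : ℤ) = a by omega]
  have e1 := (hle i p).trans (hC p)
  have e2 := (hle (a + m) s).trans (hC s)
  have e3 := hLu N
  have hNr : (N : ℝ) = p + (m + s) := by exact_mod_cast hNeq
  have e4 : L * N = L * p + L * m + L * s := by rw [hNr]; ring
  have hmγ : 0 < b - γ := sub_pos.2 hγ
  have e5 : (b - γ) / 4 * (δ * N) ≤ (b - γ) / 4 * m :=
    mul_le_mul_of_nonneg_left hm (by positivity)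
  have e6 : ε * N = (b - γ) / 4 * (δ * N) := by rw [hε]; ring
  have e7 : ε * N = ε * p + ε * m + ε * s := by rw [hNr]; ring
  have e8 : b * m ≤ L * m := mul_le_mul_of_nonneg_right hbL (Nat.cast_nonneg _)
  have e9 : 0 ≤ ε * m := by positivity
  have e10 : 0 ≤ (b - γ) * m := by positivity
  nlinarith

/-- In a right recurrent sequence with fewer than `(3 - η) n` factors of each large length `n`, the
means of a function of the letters over long blocks cannot stay both small in places and large in
places. -/
theorem false_of_blockSum_of_rightRecurrent {a η : ℝ} (hrec : RightRecurrent x) (hη : 0 < η)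
    (hP : ∀ᶠ n : ℕ in atTop, (numFactors x n : ℝ) ≤ (3 - η) * n) (hab : a < b)
    (ha : ∀ n : ℕ, ∃ i, blockSum F x i n ≤ a * n)
    (hb : ∀ n : ℕ, ∃ i, b * n ≤ blockSum F x i n) : False := by
  -- Once `4 ≤ δ * n`, rounding costs little: `4 * K n ≤ 8 * δ * n ≤ η * n`, and `2 * K n ≤ n`.
  -- Windows have length `20 * n`, which is why `δ / 20` is used below.
  obtain ⟨δ, hδ0, hδη, hδ1⟩ : ∃ δ : ℝ, 0 < δ ∧ 8 * δ ≤ η ∧ 8 * δ ≤ 1 :=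
    ⟨min η 1 / 8, by positivity, by linarith [min_le_left η 1], by linarith [min_le_right η 1]⟩
  set γ := (a + b) / 2 with hγ
  set K : ℕ → ℕ := fun n => ⌈δ * n⌉₊ with hK
  have habove := eventually_exists_above (γ := γ) (by linarith) hb (δ := δ / 20) (by positivity)
  have hbelow := eventually_exists_above (F := fun b => -F b) (γ := -γ) (b := -a) (x := x)
    (by linarith) (fun n => by
      obtain ⟨i, hi⟩ := ha n
      exact ⟨i, by rw [blockSum_neg]; linarith⟩) (δ := δ / 20) (by positivity)
  have hmul : Tendsto (fun n : ℕ => 20 * n) atTop atTop :=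
    tendsto_id.const_mul_atTop' (by norm_num)
  have hlarge : ∀ᶠ n : ℕ in atTop, 4 ≤ δ * n :=
    (tendsto_natCast_atTop_atTop.const_mul_atTop hδ0).eventually_ge_atTop 4
  have hgood : ∀ᶠ n : ℕ in atTop, GoodScale F γ x K n := by
    filter_upwards [hmul.eventually habove, hmul.eventually hbelow, hlarge, hP]
      with n h1 h2 h3 h4
    have k1 : δ * n ≤ K n := Nat.le_ceil _
    have k2 : (K n : ℝ) < δ * n + 1 := Nat.ceil_lt_add_one (by positivity)
    have hn0 : (0 : ℝ) ≤ n := Nat.cast_nonneg _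
    have k3 : 8 * δ * n ≤ η * n := mul_le_mul_of_nonneg_right hδη hn0
    have k4 : 8 * δ * n ≤ 1 * n := mul_le_mul_of_nonneg_right hδ1 hn0
    have hblock : ∀ m : ℕ, K n ≤ m → δ / 20 * ((20 * n : ℕ) : ℝ) ≤ m := by
      intro m hm
      have : (K n : ℝ) ≤ m := by exact_mod_cast hm
      push_cast
      linarith
    refine ⟨?_, ?_, ?_, ?_, ?_⟩
    · have : (numFactors x n : ℝ) + 4 * K n ≤ 3 * n := by linarith
      exact_mod_cast this
    · have : 2 * (K n : ℝ) ≤ n := by linarith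
      exact_mod_cast this
    · have : (3 : ℝ) ≤ K n := by linarith
      exact_mod_cast this
    · obtain ⟨i, hi⟩ := h1
      exact ⟨i, fun a m hm h5 h6 => hi a m (hblock m hm) h5 h6⟩
    · obtain ⟨i, hi⟩ := h2
      exact ⟨i, fun a m hm h5 h6 => hi a m (hblock m hm) h5 h6⟩
  obtain ⟨n₀, hn₀⟩ := eventually_atTop.1 hgood
  obtain ⟨m, hm⟩ := exists_forall_numFactors_add_three_le hrec hn₀
  have hgrow : ∀ k, 3 * k ≤ numFactors x (m + k) := by
    intro k
    induction k with
    | zero => simp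
    | succ k ih =>
      have := hm (m + k) (by omega)
      rw [← add_assoc]
      omega
  have hη' : ∀ᶠ n : ℕ in atTop, 3 * (m : ℝ) < η * n :=
    (tendsto_natCast_atTop_atTop.const_mul_atTop hη).eventually_gt_atTop _
  obtain ⟨n, h1, h2, h3⟩ := (hη'.and (hP.and (eventually_ge_atTop m))).exists
  have h4 := hgrow (n - m)
  rw [Nat.add_sub_cancel' h3] at h4
  have h5 : (3 * (n - m : ℕ) : ℝ) ≤ numFactors x n := by exact_mod_cast h4
  rw [Nat.cast_sub h3] at h5
  linarith

end Stretch

/-! ### Reflection and recoding by factors -/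

section Recoding

variable {B : Type*} {x : ℤ → B} {F : B → ℝ} {n m : ℕ}

theorem numFactors_le_of_determines {B' : Type*} [Finite B] {y : ℤ → B'} {f : ℤ → ℤ}
    (h : ∀ i j, SameFactor x n (f i) (f j) → SameFactor y m i j) (hf : Function.Surjective f) :
    numFactors y m ≤ numFactors x n := by
  have hr : Set.range (fun i => factor x n (f i)) = Set.range (factor x n) :=
    hf.range_comp (factor x n)
  have := ncard_range_add_card_le (u := fun i => factor x n (f i)) (v := factor y m)
    (Set.toFinite _) (fun i j hij => factor_eq_iff.2 (h i j (factor_eq_iff.1 hij))) ∅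
    (by simp) (by simp)
  rw [hr] at this
  simpa [numFactors] using this

theorem sameFactor_neg_iff {i j : ℤ} : SameFactor (fun k => x (-k)) n i j ↔
    SameFactor x n (-i - n + 1) (-j - n + 1) := by
  constructor
  · intro h s h0 h1
    have := h (n - 1 - s) (by omega) (by omega)
    simp only at this
    rwa [show -(i + (n - 1 - s)) = -i - n + 1 + s by ring,
      show -(j + (n - 1 - s)) = -j - n + 1 + s by ring] at this
  · intro h s h0 h1
    have := h (n - 1 - s) (by omega) (by omega)
    rwa [show -i - n + 1 + (n - 1 - s) = -(i + s) by ring,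
      show -j - n + 1 + (n - 1 - s) = -(j + s) by ring] at this

theorem numFactors_neg_le [Finite B] : numFactors (fun k => x (-k)) n ≤ numFactors x n :=
  numFactors_le_of_determines (f := fun i => -i - n + 1) (fun _ _ h => sameFactor_neg_iff.2 h)
    (fun i => ⟨-i - n + 1, by dsimp only; ring⟩)

theorem blockSum_comp_neg (i : ℤ) :
    blockSum F (fun k => x (-k)) i n = blockSum F x (-i - n + 1) n := by
  unfold blockSum
  rw [← Finset.sum_range_reflect]
  refine Finset.sum_congr rfl fun k hk => ?_
  rw [Finset.mem_range] at hk
  congr 2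
  rw [Nat.sub_sub, Nat.cast_sub (by omega)]
  push_cast
  ring_nf

/-- If every factor of `x` occurs at least twice, then all factors recur arbitrarily far to the
right, or all factors recur arbitrarily far to the left. -/
theorem rightRecurrent_or (h : ∀ n i, ∃ j, j ≠ i ∧ SameFactor x n j i) :
    RightRecurrent x ∨ RightRecurrent (fun k => x (-k)) := by
  by_contra hcon
  rw [not_or] at hcon
  obtain ⟨h1, h2⟩ := hcon
  unfold RightRecurrent at h1 h2
  push Not at h1 h2
  obtain ⟨n₁, i₁, N₁, h1⟩ := h1
  obtain ⟨n₂, i₂, N₂, h2⟩ := h2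
  have h2' : ∀ j, j ≤ -N₂ - n₂ + 1 → ¬ SameFactor x n₂ j (-i₂ - n₂ + 1) := by
    intro j hj hs
    refine h2 (-j - n₂ + 1) (by omega) (sameFactor_neg_iff.2 ?_)
    rwa [show -(-j - n₂ + 1) - n₂ + 1 = j by ring]
  set k₂ := -i₂ - n₂ + 1
  -- A single factor of length `L` at `A` contains both the factor that fails to recur to the right
  -- and the one that fails to recur to the left, so its occurrences are bounded on both sides.
  set A := min i₁ k₂ with hA
  obtain ⟨L, hL⟩ : ∃ L : ℕ, i₁ + n₁ ≤ A + L ∧ k₂ + n₂ ≤ A + L :=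
    ⟨(max (i₁ + n₁) (k₂ + n₂) - A).toNat, by omega, by omega⟩
  have hup : ∀ j, SameFactor x L j A → j < N₁ - (i₁ - A) := by
    intro j hj
    by_contra hc
    exact h1 (j + (i₁ - A)) (by omega) (hj.sub_apply (by ring) (by omega) (by omega))
  have hdown : ∀ j, SameFactor x L j A → -N₂ - n₂ + 1 - (k₂ - A) < j := by
    intro j hj
    by_contra hc
    exact h2' (j + (k₂ - A)) (by omega) (hj.sub_apply (by ring) (by omega) (by omega))
  obtain ⟨jmax, hjmax, hmax⟩ := Int.exists_greatest_of_bdd (P := fun j => SameFactor x L j A)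
    ⟨_, fun j hj => (hup j hj).le⟩ ⟨A, SameFactor.refl A⟩
  obtain ⟨jmin, hjmin, hmin⟩ := Int.exists_least_of_bdd (P := fun j => SameFactor x L j A)
    ⟨_, fun j hj => (hdown j hj).le⟩ ⟨A, SameFactor.refl A⟩
  have hle := hmin jmax hjmax
  -- The factor from the first occurrence through the last occurs only once: a translate would
  -- contain an occurrence outside the extremes.
  obtain ⟨j, hj, hj'⟩ := h ((jmax - jmin).toNat + L) jmin
  have e1 := hmin j ((hj'.mono (by omega)).trans hjmin)
  have e2 := hmax (j + (jmax - jmin))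
    ((hj'.sub_apply (t := jmax) (by ring) (by omega) (by push_cast; omega)).trans hjmax)
  omega

theorem false_of_blockSum [Finite B] {a b η : ℝ} (hrec : ∀ n i, ∃ j, j ≠ i ∧ SameFactor x n j i)
    (hη : 0 < η) (hP : ∀ᶠ n : ℕ in atTop, (numFactors x n : ℝ) ≤ (3 - η) * n) (hab : a < b)
    (ha : ∀ n : ℕ, ∃ i, blockSum F x i n ≤ a * n)
    (hb : ∀ n : ℕ, ∃ i, b * n ≤ blockSum F x i n) : False := by
  rcases rightRecurrent_or hrec with h | h
  · exact false_of_blockSum_of_rightRecurrent h hη hP hab ha hb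
  · refine false_of_blockSum_of_rightRecurrent (F := F) h hη ?_ hab ?_ ?_
    · filter_upwards [hP] with n hn
      exact le_trans (by exact_mod_cast numFactors_neg_le) hn
    · intro n
      obtain ⟨i, hi⟩ := ha n
      refine ⟨-i - n + 1, ?_⟩
      rwa [blockSum_comp_neg, show -(-i - n + 1) - (n : ℤ) + 1 = i by ring]
    · intro n
      obtain ⟨i, hi⟩ := hb n
      refine ⟨-i - n + 1, ?_⟩
      rwa [blockSum_comp_neg, show -(-i - n + 1) - (n : ℤ) + 1 = i by ring]

theorem sameFactor_factor {i j : ℤ} (h : SameFactor x (n + m) i j) :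
    SameFactor (factor x m) n i j :=
  fun s _ _ => factor_eq_iff.2 (h.sub_apply (by ring) (by omega) (by push_cast; omega))

/-- The version for functions of factors of length `m` instead of letters. -/
theorem false_of_blockSum_factor [Finite B] {a b η : ℝ} {F : (Fin m → B) → ℝ}
    (hrec : ∀ n i, ∃ j, j ≠ i ∧ SameFactor x n j i)
    (hη : 0 < η) (hP : ∀ᶠ n : ℕ in atTop, (numFactors x n : ℝ) ≤ (3 - η) * n) (hab : a < b)
    (ha : ∀ n : ℕ, ∃ i, blockSum F (factor x m) i n ≤ a * n)
    (hb : ∀ n : ℕ, ∃ i, b * n ≤ blockSum F (factor x m) i n) : False := by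
  refine false_of_blockSum (x := factor x m) (F := F) ?_ (half_pos hη) ?_ hab ha hb
  · intro n i
    obtain ⟨j, hj, hj'⟩ := hrec (n + m) i
    exact ⟨j, hj, sameFactor_factor hj'⟩
  -- Recoded factors of length `n` are determined by factors of length `n + m`; half of `η` absorbs
  -- the shift by `m`.
  · have hlarge : ∀ᶠ n : ℕ in atTop, 3 * (m : ℝ) ≤ η / 2 * n :=
      (tendsto_natCast_atTop_atTop.const_mul_atTop (half_pos hη)).eventually_ge_atTop _
    have hshift : Tendsto (fun n : ℕ => n + m) atTop atTop := tendsto_add_atTop_nat m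
    filter_upwards [hshift.eventually hP, hlarge] with n h1 h2
    have h3 : (numFactors (factor x m) n : ℝ) ≤ numFactors x (n + m) := by
      exact_mod_cast numFactors_le_of_determines (f := id) (fun i j h => sameFactor_factor h)
        Function.surjective_id
    push_cast at h1
    have h4 : 0 ≤ η * m := by positivity
    nlinarith

end Recoding

/-! ### Existence of an invariant measure -/

/-- **Krylov–Bogolyubov theorem**: a continuous self-map of a compact space has an invariant
probability measure on each nonempty closed set that it maps to itself. -/
theorem exists_measurePreserving_of_mapsTo {E : Type*} [TopologicalSpace E] [CompactSpace E]
    [T2Space E] [MeasurableSpace E] [BorelSpace E] [HasOuterApproxClosed E] {T : E → E}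
    (hT : Continuous T) {X : Set E} (hX : IsClosed X) (hTX : Set.MapsTo T X X) {x : E}
    (hx : x ∈ X) :
    ∃ μ : Measure E, IsProbabilityMeasure μ ∧ MeasurePreserving T μ μ ∧ μ Xᶜ = 0 := by
  set ν : ℕ → Measure E := fun n =>
    ((n + 1 : ℕ) : ENNReal)⁻¹ • ∑ k ∈ Finset.range (n + 1), Measure.dirac (T^[k] x) with hν
  have hνX : ∀ n, ∀ S : Set E, MeasurableSet S → X ⊆ S → ν n S = 1 := by
    intro n S hS hXS
    have : ∀ k ∈ Finset.range (n + 1), Measure.dirac (T^[k] x) S = 1 := fun k _ =>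
      Measure.dirac_apply_of_mem (hXS (hTX.iterate k hx))
    simp only [hν, Measure.smul_apply, Measure.coe_finsetSum, Finset.sum_apply, smul_eq_mul]
    rw [Finset.sum_congr rfl this]
    simp only [Finset.sum_const, Finset.card_range, nsmul_eq_mul, mul_one]
    exact ENNReal.inv_mul_cancel (by simp) (by simp)
  have hprob : ∀ n, IsProbabilityMeasure (ν n) := fun n =>
    ⟨hνX n _ MeasurableSet.univ (Set.subset_univ _)⟩
  have hint : ∀ n (f : BoundedContinuousFunction E ℝ),
      ∫ y, f y ∂ν n = ((n + 1 : ℕ) : ℝ)⁻¹ * ∑ k ∈ Finset.range (n + 1), f (T^[k] x) := by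
    intro n f
    simp only [hν]
    rw [integral_smul_measure, integral_finsetSum_measure (fun k _ => f.integrable _),
      ENNReal.toReal_inv, ENNReal.toReal_natCast, smul_eq_mul]
    simp only [integral_dirac]
  -- The space of probability measures is compact, so the orbit averages converge along an
  -- ultrafilter. Invariance of the limit follows by telescoping.
  obtain ⟨U, hU⟩ := Ultrafilter.exists_le (atTop : Filter ℕ)
  set P : ℕ → ProbabilityMeasure E := fun n => ⟨ν n, hprob n⟩ with hP
  obtain ⟨μ, -, hμ⟩ := isCompact_univ.ultrafilter_le_nhds (U.map P) (by simp)
  have hlim : Tendsto P U (nhds μ) := hμ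
  refine ⟨μ, inferInstance, ⟨hT.measurable, ?_⟩, ?_⟩
  · have := Measure.isProbabilityMeasure_map (μ := (μ : Measure E)) hT.measurable.aemeasurable
    refine ext_of_forall_integral_eq_of_IsFiniteMeasure fun f => ?_
    rw [integral_map hT.measurable.aemeasurable f.continuous.aestronglyMeasurable]
    have h1 := ProbabilityMeasure.tendsto_iff_forall_integral_tendsto.1 hlim f
    have h2 := ProbabilityMeasure.tendsto_iff_forall_integral_tendsto.1 hlim
      (f.compContinuous ⟨T, hT⟩)
    refine tendsto_nhds_unique h2 ?_
    have h3 : Tendsto (fun n : ℕ => ((n + 1 : ℕ) : ℝ)⁻¹ * (2 * ‖f‖)) U (nhds 0) := by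
      rw [← zero_mul (2 * ‖f‖)]
      refine Tendsto.mul_const _ (Tendsto.mono_left ?_ hU)
      exact tendsto_inv_atTop_zero.comp
        (tendsto_natCast_atTop_atTop.comp (tendsto_add_atTop_nat 1))
    have h4 : Tendsto (fun n => ∫ y, (f.compContinuous ⟨T, hT⟩) y ∂ν n - ∫ y, f y ∂ν n) U
        (nhds 0) := by
      refine squeeze_zero_norm (fun n => ?_) h3
      rw [hint, hint, ← mul_sub, norm_mul, ← Finset.sum_sub_distrib]
      have h5 : ∑ k ∈ Finset.range (n + 1),
          ((f.compContinuous ⟨T, hT⟩) (T^[k] x) - f (T^[k] x)) = f (T^[n + 1] x) - f x := by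
        have := Finset.sum_range_sub (fun k => f (T^[k] x)) (n + 1)
        simp only [Function.iterate_succ_apply'] at this ⊢
        simpa using this
      rw [h5, Real.norm_of_nonneg (by positivity : (0 : ℝ) ≤ ((n + 1 : ℕ) : ℝ)⁻¹)]
      gcongr
      exact f.dist_le_two_norm _ _
    have h6 := h4.add h1
    rw [zero_add] at h6
    refine h6.congr fun n => ?_
    simp [hP]
  · have h1 := ProbabilityMeasure.limsup_measure_closed_le_of_tendsto hlim hX
    have h2 : ∀ n, (P n : Measure E) X = 1 := fun n => hνX n X hX.measurableSet subset_rfl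
    simp only [h2, limsup_const] at h1
    rw [prob_compl_eq_zero_iff hX.measurableSet]
    exact le_antisymm prob_le_one h1

/-! ### Invariant measures on an orbit closure and frequencies in `x` -/

section Subshift

variable {A : Type*} {x : ℤ → A}

theorem occursAt_iff_factor_eq {n : ℕ} {w : Fin n → A} {i : ℤ} :
    OccursAt w x i ↔ factor x n i = w :=
  ⟨fun h => funext h, fun h k => congrFun h k⟩

theorem shift_one_iterate (k : ℕ) (z : ℤ → A) : (shift (1 : ℤ))^[k] z = shift (k : ℤ) z := by
  induction k with
  | zero => funext i; simp [shift]
  | succ k ih =>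
    rw [Function.iterate_succ_apply', ih]
    funext i
    simp only [SymbolicDynamics.FullShift.shift_apply]
    congr 1
    push_cast
    ring

theorem factor_shift (m : ℕ) (k i : ℤ) (z : ℤ → A) :
    factor (shift k z) m i = factor z m (k + i) := by
  funext j
  simp [factor, add_assoc]

theorem exists_eq_of_mem_closure_shiftOrbit [TopologicalSpace A] [DiscreteTopology A] {z : ℤ → A}
    (hz : z ∈ closure (shiftOrbit x)) (n : ℕ) (j : ℤ) :
    ∃ i, ∀ s : ℤ, 0 ≤ s → s < n → x (i + s) = z (j + s) := by
  have hopen := SymbolicDynamics.FullShift.isOpen_cylinder (Finset.Ico j (j + n)) z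
  obtain ⟨_, hy, ⟨k, rfl⟩⟩ := mem_closure_iff.1 hz _ hopen
    (SymbolicDynamics.FullShift.mem_cylinder.2 fun _ _ => rfl)
  refine ⟨k + j, fun s h0 h1 => ?_⟩
  have := SymbolicDynamics.FullShift.mem_cylinder.1 hy (j + s)
    (Finset.mem_Ico.2 ⟨by omega, by omega⟩)
  rw [← this]
  simp [add_assoc]

theorem complexity_eq_numFactors [TopologicalSpace A] [DiscreteTopology A] (X : Subshift A ℤ)
    (hX : X.carrier = closure (shiftOrbit x)) (n : ℕ) : complexity X n = numFactors x n := by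
  unfold complexity numFactors
  congr 1
  ext w
  simp only [wordsOfLength, Set.mem_ofPred_eq, Set.mem_range, occursAt_iff_factor_eq]
  constructor
  · rintro ⟨z, hz, j, rfl⟩
    rw [hX] at hz
    obtain ⟨i, hi⟩ := exists_eq_of_mem_closure_shiftOrbit hz n j
    exact ⟨i, funext fun k => hi k (by omega) (by have := k.2; omega)⟩
  · rintro ⟨i, rfl⟩
    exact ⟨x, hX ▸ subset_closure ⟨0, by funext i; simp⟩, i, rfl⟩

theorem measurable_factor [MeasurableSpace A] (m : ℕ) (i : ℤ) : Measurable fun z : ℤ → A => factor z m i :=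
  measurable_pi_lambda _ fun k => measurable_pi_apply (i + (k : ℕ) : ℤ)

variable [Finite A] [TopologicalSpace A] [DiscreteTopology A] [MeasurableSpace A] [BorelSpace A]

variable {μ ν : Measure (ℤ → A)}

/-- An invariant probability measure on the orbit closure of `x` gives a word a mass that lies
between frequencies of the word in factors of `x`. -/
theorem exists_blockSum_le_and_le [IsProbabilityMeasure μ]
    (hμ : MeasurePreserving (shift (1 : ℤ)) μ μ) (hμX : μ (closure (shiftOrbit x))ᶜ = 0) {m : ℕ}
    (w : Fin m → A) (n : ℕ) [DecidableEq (Fin m → A)] :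
    (∃ i, blockSum (fun v => if v = w then (1 : ℝ) else 0) (factor x m) i n ≤
      μ.real {z | factor z m 0 = w} * n) ∧
    ∃ i, μ.real {z | factor z m 0 = w} * n ≤
      blockSum (fun v => if v = w then (1 : ℝ) else 0) (factor x m) i n := by
  set F : (Fin m → A) → ℝ := fun v => if v = w then (1 : ℝ) else 0 with hF
  set S : Set (ℤ → A) := {z | factor z m 0 = w} with hS
  have hSm : MeasurableSet S := measurable_factor m 0 (measurableSet_singleton w)
  have hFS : ∀ (k : ℕ) (z : ℤ → A), F (factor z m k) =
      S.indicator (fun _ => (1 : ℝ)) ((shift (1 : ℤ))^[k] z) := by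
    intro k z
    rw [shift_one_iterate, Set.indicator_apply]
    simp only [hF, hS, Set.mem_ofPred_eq, factor_shift, add_zero]
  have hind : Integrable (S.indicator fun _ => (1 : ℝ)) μ := (integrable_const 1).indicator hSm
  have hi : ∀ k : ℕ, Integrable (fun z => F (factor z m k)) μ := by
    intro k
    simp only [hFS]
    exact (hμ.iterate k).integrable_comp_of_integrable hind
  have hint : ∀ k : ℕ, ∫ z, F (factor z m k) ∂μ = μ.real S := by
    intro k
    simp only [hFS]
    rw [← integral_map (φ := (shift (1 : ℤ))^[k]) (hμ.iterate k).measurable.aemeasurable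
      (by rw [(hμ.iterate k).map_eq]; exact hind.aestronglyMeasurable), (hμ.iterate k).map_eq,
      integral_indicator_const _ hSm, smul_eq_mul, mul_one]
  -- By invariance `G` has integral `μ.real S * n`, so off the null set it takes a value at most
  -- this mean and a value at least this mean. Every window of a point of the orbit closure occurs
  -- in `x`.
  set G : (ℤ → A) → ℝ := fun z => ∑ k ∈ Finset.range n, F (factor z m k) with hG
  have hGi : Integrable G μ := integrable_finsetSum _ fun k _ => hi k
  have hGint : ∫ z, G z ∂μ = μ.real S * n := by
    rw [integral_finsetSum _ fun k _ => hi k, Finset.sum_congr rfl fun k _ => hint k]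
    simp [mul_comm]
  have htransfer : ∀ z, z ∉ (closure (shiftOrbit x))ᶜ → ∃ i, blockSum F (factor x m) i n = G z := by
    intro z hz
    obtain ⟨i, hi⟩ := exists_eq_of_mem_closure_shiftOrbit (not_not.1 hz) (n + m) 0
    refine ⟨i, Finset.sum_congr rfl fun k hk => ?_⟩
    rw [Finset.mem_range] at hk
    congr 1
    funext j
    have := hi (k + (j : ℕ)) (by omega) (by have := j.2; push_cast; omega)
    rw [zero_add] at this
    simpa [factor, add_assoc] using this
  constructor
  · obtain ⟨z, hz, hz'⟩ := exists_notMem_null_le_integral hGi hμX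
    obtain ⟨i, hi⟩ := htransfer z hz
    exact ⟨i, by rw [hi, ← hGint]; exact hz'⟩
  · obtain ⟨z, hz, hz'⟩ := exists_notMem_null_integral_le hGi hμX
    obtain ⟨i, hi⟩ := htransfer z hz
    exact ⟨i, by rw [hi, ← hGint]; exact hz'⟩

/-- An invariant probability measure is determined by the masses of the words. -/
theorem measure_ext_of_factor [IsProbabilityMeasure μ] [IsProbabilityMeasure ν]
    (hμ : MeasurePreserving (shift (1 : ℤ)) μ μ) (hν : MeasurePreserving (shift (1 : ℤ)) ν ν)
    (h : ∀ (m : ℕ) (w : Fin m → A), μ.real {z | factor z m 0 = w} = ν.real {z | factor z m 0 = w}) :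
    μ = ν := by
  have hmap : ∀ N : ℕ, μ.map (fun z => factor z (2 * N) (-N)) =
      ν.map (fun z => factor z (2 * N) (-N)) := by
    intro N
    refine Measure.ext_of_singleton fun w => ?_
    rw [Measure.map_apply (measurable_factor _ _) (measurableSet_singleton w),
      Measure.map_apply (measurable_factor _ _) (measurableSet_singleton w)]
    set S : Set (ℤ → A) := (fun z => factor z (2 * N) (-N)) ⁻¹' {w} with hS
    have hSm : MeasurableSet S := measurable_factor _ _ (measurableSet_singleton w)
    have hpre : (shift (1 : ℤ))^[N] ⁻¹' S = {z | factor z (2 * N) 0 = w} := by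
      ext z
      simp [hS, shift_one_iterate, factor_shift]
    rw [← (hμ.iterate N).measure_preimage hSm.nullMeasurableSet,
      ← (hν.iterate N).measure_preimage hSm.nullMeasurableSet, hpre]
    exact (measureReal_eq_measureReal_iff).1 (h _ w)
  -- Finite-dimensional marginals determine the measure, and each is an image of the distribution on
  -- a centred window.
  refine IsProjectiveLimit.unique (P := fun I => μ.map I.restrict) (fun I => rfl) fun I => ?_
  obtain ⟨N, hN⟩ : ∃ N : ℕ, ∀ i ∈ I, -(N : ℤ) ≤ i ∧ i < N := by
    refine ⟨∑ i ∈ I, (i.natAbs + 1), fun i hi => ?_⟩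
    have := Finset.single_le_sum (f := fun i : ℤ => i.natAbs + 1) (fun _ _ => Nat.zero_le _) hi
    omega
  set φ : (Fin (2 * N) → A) → (I → A) := fun v i =>
    v ⟨(i.1 + N).toNat, by have := hN i.1 i.2; omega⟩ with hφ
  have hφm : Measurable φ := measurable_pi_lambda _ fun i => measurable_pi_apply _
  have hcomp : (I.restrict : (ℤ → A) → (I → A)) = φ ∘ fun z => factor z (2 * N) (-N) := by
    funext z i
    have := hN i.1 i.2
    simp only [hφ, Function.comp, factor, Finset.restrict]
    congr 1
    rw [Int.toNat_of_nonneg (by omega)]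
    ring
  change ν.map I.restrict = μ.map I.restrict
  rw [hcomp, ← Measure.map_map hφm (measurable_factor _ _),
    ← Measure.map_map hφm (measurable_factor _ _), hmap N]

end Subshift

/-! ### Unique ergodicity -/

theorem theorem1p3 {A : Type*} [Finite A] [TopologicalSpace A] [DiscreteTopology A]
    [MeasurableSpace A] [BorelSpace A]
    (X : Subshift A ℤ) (x : ℤ → A)
    (hX : X.carrier = closure (shiftOrbit x))
    (hrec : RecurrentPoint x) (haper : AperiodicPoint x)
    (hc : limsup (fun n : ℕ => (((complexity X n : ℝ) / (n : ℝ) : ℝ) : EReal)) atTop < 3) :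
    UniquelyErgodic X := by
  classical
  have hrec' : ∀ n i, ∃ j, j ≠ i ∧ SameFactor x n j i := by
    intro n i
    obtain ⟨j, hj, hj'⟩ := hrec n (factor x n i) i (occursAt_iff_factor_eq.2 rfl)
    exact ⟨j, hj, factor_eq_iff.1 (occursAt_iff_factor_eq.1 hj')⟩
  obtain ⟨η, hη, hP⟩ : ∃ η : ℝ, 0 < η ∧
      ∀ᶠ n : ℕ in atTop, (numFactors x n : ℝ) ≤ (3 - η) * n := by
    obtain ⟨c, hc1, hc2⟩ := EReal.lt_iff_exists_real_btwn.1 hc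
    have hc3 : c < 3 := EReal.coe_lt_coe_iff.1 hc2
    refine ⟨3 - c, by linarith, ?_⟩
    filter_upwards [eventually_lt_of_limsup_lt hc1, eventually_gt_atTop 0] with n hn hn0
    have h1 : (complexity X n : ℝ) / n < c := by exact_mod_cast hn
    rw [div_lt_iff₀ (by exact_mod_cast hn0), complexity_eq_numFactors X hX] at h1
    linarith
  have hx : x ∈ X.carrier := hX ▸ subset_closure ⟨0, by funext i; simp⟩
  let _ := TopologicalSpace.metrizableSpaceMetric (ℤ → A)
  obtain ⟨μ, hμ1, hμ2, hμ3⟩ := exists_measurePreserving_of_mapsTo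
    (SymbolicDynamics.FullShift.continuous_shift (1 : ℤ)) X.isClosed (X.mapsTo 1) hx
  refine ⟨μ, ⟨hμ1, hμ2, hμ3⟩, ?_⟩
  rintro ν ⟨hν1, hν2, hν3⟩
  rw [hX] at hμ3 hν3
  refine measure_ext_of_factor hν2 hμ2 fun m w => ?_
  -- Different masses of a word are exactly the numbers `a < b` that the combinatorial argument
  -- excludes.
  have key : ∀ {μ ν : Measure (ℤ → A)} [IsProbabilityMeasure μ] [IsProbabilityMeasure ν],
      MeasurePreserving (shift (1 : ℤ)) μ μ → MeasurePreserving (shift (1 : ℤ)) ν ν →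
      μ (closure (shiftOrbit x))ᶜ = 0 → ν (closure (shiftOrbit x))ᶜ = 0 →
      ¬ μ.real {z | factor z m 0 = w} < ν.real {z | factor z m 0 = w} := by
    intro μ ν _ _ hμ hν hμX hνX hlt
    exact false_of_blockSum_factor hrec' hη hP hlt
      (fun n => (exists_blockSum_le_and_le hμ hμX w n).1)
      (fun n => (exists_blockSum_le_and_le hν hνX w n).2)
  exact le_antisymm (not_lt.1 (key hμ2 hν2 hμ3 hν3)) (not_lt.1 (key hν2 hμ2 hν3 hμ3))
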